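/- Model. A seller offers a freely replicable good to $n$ buyers. Buyer $i$ has a private type $t_i=(v_i,(\eta_{j\gets i})_{j\ne i})$: her value $v_i\in[\underline v_i,\overline v_i]\subset[0,\infty)$ for the good, and the externalities $\eta_{j\gets i}\ge 0$ (each in a bounded interval) that she causes on the others. If allocations are $x\in[0,1]^n$ and payments are $p\in[0,\infty)^n$, her utility is $v_ix_i-\sum_{j\neq i}\eta_{i\gets j}x_j-p_i$. Types of different buyers are independent; $v_i$ is independent of $(\eta_{j\gets i})_{j\ne i}$ and has a density $f_i$ on $[\underline v_i,\overline v_i]$ with distribution function $F_i$. Put $c_i=\sum_{j\ne i}\mathbb E[\eta_{j\gets i}]$, and assume that $v\mapsto vf_i(v)-(1-F_i(v))-f_i(v)c_i$ is non-decreasing on $[\underline v_i,\overline v_i]$ for each $i$. A mechanism consists of an allocation and a payment for every vector of bids, where a bid is a type or non-participation, and a buyer who does not participate gets and pays nothing. It is BNIC if, in expectation over the other buyers' truthful bids, bidding her true type is optimal for every type of every buyer among all bids that are types, and interim IR if bidding truthfully is, in the same sense, at least as good as not participating. The revenue $\mathrm{Rev}$ of a mechanism is its expected total payment under truthful bidding.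 In the posted-price mechanism with thresholds $\tau=(\tau_1,\dots,\tau_n)$, buyer $i$ gets the good iff $v_i\ge\tau_i$, and she pays $\tau_i$ if she gets it, plus $\mathbb E[\eta_{i\gets j}]$ for every $j\ne i$ who does not get it; write $\mathrm{Rev}(\tau)$ for its revenue. Algorithm. Fix parameters $\delta,\gamma>0$ and initial thresholds $\tau^1\in\prod_i[\underline v_i,\overline v_i]$. In rounds $k=1,2,\dots$ fresh types are drawn independently from the type distribution, and independent $u_i^k$ are drawn uniformly from $[-1,1]$, independently of the types. The price $\tau_i^k+\delta u_i^k$ is posted to buyer $i$, the decision $X_i^k=\mathbf 1\{v_i^k\ge\tau_i^k+\delta u_i^k\}$ is observed, and $$\tau_i^{k+1}=\Pi_i\Big(\tau_i^k+\gamma\,H_i(\tau_i^k+\delta u_i^k,X_i^k)\,\frac{u_i^k}{\delta}\Big),\qquad H_i(p,X)=p-(1-X)(p-c_i),$$ where $\Pi_i$ is the projection onto $[\underline v_i+\delta,\overline v_i-\delta]$. Let $\overline\tau_K=\frac1K\sum_{k=1}^K\tau^k$. Claim. For all real $w>0$ and $B$ there is a constant $C$ such that for every integer $K\ge1$ there are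 $\gamma>0$ and $\delta\in(0,w/2)$ with the following property. For every $n$ and every market as above with $\overline v_i-\underline v_i\ge w$, $\overline v_i\le B$ and $c_i\le B$ for all $i$, and for every choice of $\tau^1$, the random variable $\mathrm{Rev}(\overline\tau_K)$ is integrable, and $$\mathrm{Rev}(\tau)-\mathbb E\big[\mathrm{Rev}(\overline\tau_K)\big]\le C\,\frac{n}{K^{1/4}}$$ for every $\tau\in\prod_i[\underline v_i,\overline v_i]$ (in particular for revenue-maximizing thresholds $\tau^\star$), and likewise $$\mathrm{Rev}(x,p)-\mathbb E\big[\mathrm{Rev}(\overline\tau_K)\big]\le C\,\frac{n}{K^{1/4}}$$ for every BNIC and interim IR mechanism $(x,p)$ (with measurable allocations and payments, and integrable payments). -/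

import Mathlib

open MeasureTheory ProbabilityTheory
open scoped ENNReal

noncomputable section

namespace DataMarket

/-- The private type `(v_i, (η_{j←i})_{j ≠ i})` of bidder `i`: her value for the good, and the
externalities that she causes on the other bidders. -/
abbrev BidderType (n : ℕ) (i : Fin n) : Type := ℝ × ({j : Fin n // j ≠ i} → ℝ)

/-- Vectors of types, one for each bidder. -/
abbrev Profile (n : ℕ) : Type := ∀ i : Fin n, BidderType n i

/-- Vectors of bids; the bid `none` means that the bidder does not participate. -/
abbrev BidProfile (n : ℕ) : Type := ∀ i : Fin n, Option (BidderType n i)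

/-- Everybody participates and bids her type. -/
def truthful {n : ℕ} (t : Profile n) : BidProfile n := fun i => some (t i)

/-- The externality `η_{i←j}` that bidder `j ≠ i` causes on bidder `i`. It belongs to the type
of bidder `j`. -/
def externality {n : ℕ} (t : Profile n) (i : Fin n) (j : {j : Fin n // j ≠ i}) : ℝ :=
  (t j).2 ⟨i, j.2.symm⟩

/-- The (prior) data of a market with `n` bidders. The value `v_i` has a density on
`[vlo i, vhi i]`, and `(η_{j←i})_{j ≠ i}` has law `extLaw i` on a box. -/
structure Market (n : ℕ) where
  /-- lower end of the range of values -/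
  vlo : Fin n → ℝ
  /-- upper end of the range of values -/
  vhi : Fin n → ℝ
  vlo_nonneg : ∀ i, 0 ≤ vlo i
  vlo_lt_vhi : ∀ i, vlo i < vhi i
  /-- density of `v_i` -/
  density : Fin n → ℝ → ℝ
  density_measurable : ∀ i, Measurable (density i)
  density_nonneg : ∀ i, ∀ v ∈ Set.Icc (vlo i) (vhi i), 0 ≤ density i v
  density_total : ∀ i, ∫⁻ v in Set.Icc (vlo i) (vhi i), ENNReal.ofReal (density i v) = 1
  /-- `etalo i j` is the lower end of the range of `η_{i←j}` -/
  etalo : Fin n → Fin n → ℝ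
  /-- `etahi i j` is the upper end of the range of `η_{i←j}` -/
  etahi : Fin n → Fin n → ℝ
  etalo_nonneg : ∀ i j, 0 ≤ etalo i j
  /-- law of `(η_{j←i})_{j ≠ i}` -/
  extLaw : ∀ i : Fin n, Measure ({j : Fin n // j ≠ i} → ℝ)
  extLaw_prob : ∀ i, IsProbabilityMeasure (extLaw i)
  extLaw_range : ∀ i, ∀ᵐ η ∂(extLaw i), ∀ j : {j : Fin n // j ≠ i}, η j ∈ Set.Icc (etalo j i) (etahi j i)

namespace Market

variable {n : ℕ} (M : Market n)

/-- The set `T_i` of possible types of bidder `i`. -/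
def typeSpace (i : Fin n) : Set (BidderType n i) :=
  {t | t.1 ∈ Set.Icc (M.vlo i) (M.vhi i) ∧
    ∀ j : {j : Fin n // j ≠ i}, t.2 j ∈ Set.Icc (M.etalo j i) (M.etahi j i)}

/-- The law of `v_i`. -/
def valueLaw (i : Fin n) : Measure ℝ :=
  (volume.restrict (Set.Icc (M.vlo i) (M.vhi i))).withDensity
    (fun v => ENNReal.ofReal (M.density i v))

/-- The distribution function `F_{v_i}`. -/
def valueCDF (i : Fin n) (x : ℝ) : ℝ := (M.valueLaw i).real (Set.Iic x)

/-- The law of the types of all bidders: types of different bidders are independent, and the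
value of a bidder is independent of the externalities that she causes. -/
def typeLaw : Measure (Profile n) :=
  Measure.pi fun i => (M.valueLaw i).prod (M.extLaw i)

/-- The expectation `E[η_{i←j}]`. -/
def meanExt (i : Fin n) (j : {j : Fin n // j ≠ i}) : ℝ :=
  ∫ η, η ⟨i, j.2.symm⟩ ∂(M.extLaw j)

/-- The expected total externality `∑_{j ≠ i} E[η_{j←i}]` that bidder `i` causes. -/
def causedExt (i : Fin n) : ℝ := ∑ j : {j : Fin n // j ≠ i}, ∫ η, η j ∂(M.extLaw i)

/-- The regularity condition on the distribution of values. -/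
def Regular : Prop :=
  ∀ i, MonotoneOn
    (fun v => v * M.density i v - (1 - M.valueCDF i v) - M.density i v * M.causedExt i)
    (Set.Icc (M.vlo i) (M.vhi i))

end Market

/-- An auction mechanism: allocations and payments as functions of the bids. -/
structure Mechanism (n : ℕ) where
  /-- allocation function -/
  alloc : BidProfile n → Fin n → ℝ
  /-- payment function -/
  pay : BidProfile n → Fin n → ℝ

/-- The quasilinear utility of bidder `i` with types `t`, allocations `x` and payments `p`. -/
def utility {n : ℕ} (t : Profile n) (x p : Fin n → ℝ) (i : Fin n) : ℝ :=
  (t i).1 * x i - ∑ j : {j : Fin n // j ≠ i}, externality t i j * x j - p i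

namespace Mechanism

variable {n : ℕ} (m : Mechanism n) (M : Market n)

/-- Allocations are in `[0,1]`, payments are non-negative, a bidder who does not participate
gets and pays nothing; and the expectations below are meaningful. -/
structure Feasible : Prop where
  alloc_mem : ∀ b i, m.alloc b i ∈ Set.Icc (0 : ℝ) 1
  pay_nonneg : ∀ b i, 0 ≤ m.pay b i
  outside : ∀ b i, b i = none → m.alloc b i = 0 ∧ m.pay b i = 0
  alloc_measurable : ∀ i, Measurable fun t : Profile n => m.alloc (truthful t) i
  alloc_out_measurable : ∀ i j,
    Measurable fun t : Profile n => m.alloc (Function.update (truthful t) i none) j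
  pay_measurable : ∀ i, Measurable fun t : Profile n => m.pay (truthful t) i
  pay_integrable : ∀ i, Integrable (fun t => m.pay (truthful t) i) M.typeLaw
  pay_interim_integrable : ∀ i, ∀ ti ∈ M.typeSpace i,
    Integrable (fun t => m.pay (Function.update (truthful t) i (some ti)) i) M.typeLaw

/-- The interim expected utility `V_i(b; ti)` of bidder `i` if she bids `b`, has true type `ti`,
and the others bid truthfully. As types of different bidders are independent, conditioning on
the type of bidder `i` amounts to fixing that coordinate. -/
def interimUtility (i : Fin n) (b : Option (BidderType n i)) (ti : BidderType n i) : ℝ :=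
  ∫ t, utility (Function.update t i ti)
    (m.alloc (Function.update (truthful t) i b)) (m.pay (Function.update (truthful t) i b)) i
    ∂M.typeLaw

/-- Bayes-Nash incentive compatibility. -/
def BNIC : Prop :=
  ∀ i, ∀ ti ∈ M.typeSpace i, ∀ si ∈ M.typeSpace i,
    m.interimUtility M i (some si) ti ≤ m.interimUtility M i (some ti) ti

/-- Interim individual rationality. -/
def InterimIR : Prop :=
  ∀ i, ∀ ti ∈ M.typeSpace i, m.interimUtility M i none ti ≤ m.interimUtility M i (some ti) ti

/-- The revenue: the expected total payment under truthful bidding. -/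
def rev : ℝ := ∫ t, ∑ i, m.pay (truthful t) i ∂M.typeLaw

end Mechanism

open Classical in
/-- The posted-price mechanism with thresholds `τ`. When everybody participates, bidder `i` gets
the good iff `v_i ≥ τ_i`, and pays `τ_i` if she gets it, plus `E[η_{i←j}]` for every other
bidder `j` who does not get it. If some bidder does not participate, then all participating
bidders get the good. -/
def postedPrice {n : ℕ} (M : Market n) (τ : Fin n → ℝ) : Mechanism n :=
  let x : BidProfile n → Fin n → ℝ := fun b i =>
    match b i with
    | none => 0
    | some ti => if (∃ j, b j = none) ∨ τ i ≤ ti.1 then 1 else 0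
  { alloc := x
    pay := fun b i =>
      match b i with
      | none => 0
      | some _ => x b i * τ i + ∑ j : {j : Fin n // j ≠ i}, M.meanExt i j * (1 - x b j) }

/-- The estimate `H_i(p, X)` formed from the decision `X = 1{v ≥ p}` of bidder `i` with value `v`
when the price `p` is posted to her. -/
def revEstimate {n : ℕ} (M : Market n) (i : Fin n) (p v : ℝ) : ℝ :=
  p - (1 - if p ≤ v then 1 else 0) * (p - M.causedExt i)

/-- The law of `n` independent uniform variables on `[-1,1]`. -/
def noiseLaw (n : ℕ) : Measure (Fin n → ℝ) :=
  Measure.pi fun _ => cond volume (Set.Icc (-1 : ℝ) 1)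

/-- The thresholds of the learning algorithm: `thresholds … k` is the vector after `k` updates,
so that `thresholds … 0` is the initial vector `τ₁`. In each round bidder `i`, with value
`(t k i).1`, is offered the perturbed price `τ_i + δ u_i`, and `τ_i` is updated by projected
gradient ascent, with step size `γ` and the derivative estimate `H_i(τ_i + δ u_i, X_i) u_i / δ`;
the projection is on the interval of thresholds whose perturbations stay in the range of
values. -/
def thresholds {n : ℕ} (M : Market n) (δ γ : ℝ) (τ₁ : Fin n → ℝ)
    (t : ℕ → Profile n) (u : ℕ → Fin n → ℝ) : ℕ → Fin n → ℝ
  | 0 => τ₁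
  | k + 1 => fun i =>
    let τ := thresholds M δ γ τ₁ t u k i
    max (M.vlo i + δ) (min (M.vhi i - δ)
      (τ + γ * (revEstimate M i (τ + δ * u k i) (t k i).1 * u k i / δ)))

/-- The average of the first `K` vectors of thresholds. -/
def avgThresholds {n : ℕ} (M : Market n) (δ γ : ℝ) (τ₁ : Fin n → ℝ)
    (t : ℕ → Profile n) (u : ℕ → Fin n → ℝ) (K : ℕ) : Fin n → ℝ :=
  fun i => (∑ k ∈ Finset.range K, thresholds M δ γ τ₁ t u k i) / K

/-- The revenue of the posted-price mechanism at the average of the first `K` vectors of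
thresholds. -/
def learnedRev {n : ℕ} (M : Market n) (δ γ : ℝ) (τ₁ : Fin n → ℝ)
    (t : ℕ → Profile n) (u : ℕ → Fin n → ℝ) (K : ℕ) : ℝ :=
  (postedPrice M (avgThresholds M δ γ τ₁ t u K)).rev M

end DataMarket

end

/-! Posted-price revenue is the sum over buyers of R_i(τ_i) = τ_i(1 - F_i(τ_i)) + c_i F_i(τ_i): a
buyer left without the good makes the others pay c_i in total (`rev_postedPrice`). Regularity says
that R_i is a primitive of a non-increasing function, so R_i is concave and each buyer can be
treated separately.

Learning: H_i(p, X) has mean R_i(p), so the update is stochastic ascent with a one-point gradient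
estimate. As 1 - x² vanishes at ±1 and has derivative -2x, integration by parts identifies the mean
of the estimate as one third of the derivative of the smoothing of R_i at scale δ with kernel 3/4 (1
- x²). By Jensen the smoothing lies below R_i, and a competitor moved slightly inwards loses only
O(δ) because R_i is concave and takes values in [0, B]; no Lipschitz bound is needed
(`exists_regret_le_meanGradEstimate_mul`). The squared distance to the competitor, with estimates of
size B/δ, then gives average regret O(δ + 1/(γK) + γ/δ² + 1/K) per buyer
(`Market.buyerRev_sub_integral_average_le`). Taking δ of order K^(-1/4) and γ = K^(-3/4) balances
the terms.

Benchmark: this is Myerson's argument. The externalities a buyer causes do not enter her own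
utility, so her interim utility depends on her value alone, with the interim allocation as a
subgradient. Subgradients are unique off a countable set and values have no atoms, so the interim
allocation is almost surely a function of the value (`Mechanism.exists_envelope`); hence the
expected externality of j on i factors. Not participating costs at most the full expected
externality. Revenue is then at most a sum of virtual-surplus integrals, each maximized by a
threshold (`Mechanism.exists_thresholds_rev_le`), which reduces the second bound to the first. -/

namespace DataMarket

open Set

/-! ### Primitives and subgradients on an interval -/

/-- Integration by parts for primitives of integrable functions. -/
theorem integral_mul_add_mul_of_primitive {F f Q q : ℝ → ℝ} {a b : ℝ} (hab : a ≤ b)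
    (hf : IntervalIntegrable f volume a b) (hq : IntervalIntegrable q volume a b)
    (hF : ∀ t ∈ Icc a b, F t = F a + ∫ s in a..t, f s)
    (hQ : ∀ t ∈ Icc a b, Q t = Q a + ∫ s in a..t, q s) :
    ∫ t in a..b, (f t * Q t + F t * q t) = F b * Q b - F a * Q a := by
  -- Nothing is known about `F` and `Q` outside the interval, so the explicit primitives replace
  -- them: these are absolutely continuous with the right derivative almost everywhere.
  have key : ∀ {h : ℝ → ℝ} (c : ℝ), IntervalIntegrable h volume a b →
      AbsolutelyContinuousOnInterval (fun t => c + ∫ s in a..t, h s) a b ∧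
      ∀ᵐ t, t ∈ uIcc a b → deriv (fun t => c + ∫ s in a..t, h s) t = h t := by
    intro h c hh
    constructor
    · have h1 : AbsolutelyContinuousOnInterval (fun _ : ℝ => c) a b :=
        ((LipschitzWith.const c).lipschitzOnWith (s := uIcc a b)).absolutelyContinuousOnInterval
      exact h1.add (hh.absolutelyContinuousOnInterval_intervalIntegral (c := a) (by simp))
    · filter_upwards [hh.ae_hasDerivAt_integral] with t ht htm
      simpa using ((ht htm a (by simp)).const_add c).deriv
  obtain ⟨hF1, hF2⟩ := key (F a) hf
  obtain ⟨hQ1, hQ2⟩ := key (Q a) hq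
  have h := hF1.integral_deriv_mul_eq_sub hQ1
  rw [← hF b (right_mem_Icc.2 hab), ← hQ b (right_mem_Icc.2 hab)] at h
  simp only [intervalIntegral.integral_same, add_zero] at h
  rw [← h]
  apply intervalIntegral.integral_congr_ae
  filter_upwards [hF2, hQ2] with t h1 h2 ht
  have ht' : t ∈ uIcc a b := uIoc_subset_uIcc ht
  rw [h1 ht', h2 ht']
  rw [uIcc_of_le hab] at ht'
  rw [← hF t ht', ← hQ t ht']

/-- A function with a monotone choice of subgradients is the primitive of this choice. -/
theorem integral_subgradient {u q : ℝ → ℝ} {a b : ℝ} (hq : MonotoneOn q (Icc a b))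
    (hu : ∀ x ∈ Icc a b, ∀ y ∈ Icc a b, q x * (y - x) ≤ u y - u x)
    {x y : ℝ} (hx : x ∈ Icc a b) (hy : y ∈ Icc a b) : ∫ s in x..y, q s = u y - u x := by
  have hsub : uIcc x y ⊆ Icc a b := uIcc_subset_Icc hx hy
  have hi : IntervalIntegrable q volume x y := (hq.mono hsub).intervalIntegrable
  have hbd : ∀ z ∈ Icc a b, q a ≤ q z ∧ q z ≤ q b := fun z hz =>
    ⟨hq (left_mem_Icc.2 (hz.1.trans hz.2)) hz hz.1, hq hz (right_mem_Icc.2 (hz.1.trans hz.2)) hz.2⟩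
  have hlip : ∀ z ∈ Icc a b, ∀ z' ∈ Icc a b, |u z - u z'| ≤ (|q a| + |q b|) * |z - z'| := by
    intro z hz z' hz'
    have hC : ∀ y ∈ Icc a b, |q y| ≤ |q a| + |q b| := fun y hy => by
      obtain ⟨h1, h2⟩ := hbd y hy
      rw [abs_le]
      constructor
      · linarith [neg_abs_le (q a), abs_nonneg (q b)]
      · linarith [le_abs_self (q b), abs_nonneg (q a)]
    have h1 := hu z hz z' hz'
    have h2 := hu z' hz' z hz
    have h3 : |q z * (z' - z)| ≤ (|q a| + |q b|) * |z - z'| := by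
      rw [abs_mul, abs_sub_comm z' z]
      exact mul_le_mul_of_nonneg_right (hC z hz) (abs_nonneg _)
    have h4 : |q z' * (z - z')| ≤ (|q a| + |q b|) * |z - z'| := by
      rw [abs_mul]
      exact mul_le_mul_of_nonneg_right (hC z' hz') (abs_nonneg _)
    rw [abs_le] at h3 h4 ⊢
    constructor <;> linarith
  have hcont : ContinuousOn u (Icc a b) := by
    have : LipschitzOnWith (Real.toNNReal (|q a| + |q b|)) u (Icc a b) :=
      LipschitzOnWith.of_dist_le_mul fun z hz z' hz' => by
        rw [Real.dist_eq, Real.dist_eq, Real.coe_toNNReal _ (by positivity)]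
        exact hlip z hz z' hz'
    exact this.continuousOn
  -- A monotone `q` has countably many discontinuities. At a continuity point `z`, the two
  -- subgradient inequalities squeeze the error of the linear approximation between 0 and `(q y - q
  -- z) * (y - z)`.
  refine integral_eq_of_hasDerivAt_off_countable u q
    hq.countable_not_continuousWithinAt (hcont.mono hsub) ?_ hi
  rintro z ⟨hz, hzc⟩
  have hzI : z ∈ Icc a b := hsub (by
    rw [uIcc]; exact ⟨hz.1.le, hz.2.le⟩)
  have hnhds : Icc a b ∈ nhds z := by
    refine Filter.mem_of_superset (Ioo_mem_nhds hz.1 hz.2) fun y hy => hsub ?_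
    rw [uIcc]; exact ⟨hy.1.le, hy.2.le⟩
  have hc : ContinuousAt q z := by
    by_contra h
    exact hzc ⟨hzI, fun h' => h (h'.continuousAt hnhds)⟩
  rw [hasDerivAt_iff_isLittleO, Asymptotics.isLittleO_iff]
  intro ε hε
  filter_upwards [hnhds, Metric.continuousAt_iff'.1 hc ε hε] with y hy hqy
  rw [Real.dist_eq] at hqy
  have h1 := hu z hzI y hy
  have h2 := hu y hy z hzI
  have h0 : 0 ≤ u y - u z - (y - z) * q z := by linarith
  have h3 : u y - u z - (y - z) * q z ≤ (q y - q z) * (y - z) := by linarith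
  have h4 : (q y - q z) * (y - z) ≤ ε * |y - z| := by
    refine (le_abs_self _).trans ?_
    rw [abs_mul]
    exact mul_le_mul_of_nonneg_right hqy.le (abs_nonneg _)
  simp only [smul_eq_mul, Real.norm_eq_abs]
  rw [abs_of_nonneg h0]
  linarith

/-! ### Concave functions and the one-point gradient estimate -/

section Concave

variable {R ψ : ℝ → ℝ} {a b : ℝ}

theorem sub_le_supergradient_mul (hψ : AntitoneOn ψ (Icc a b))
    (hR : ∀ x ∈ Icc a b, ∀ y ∈ Icc a b, R y - R x = ∫ s in x..y, ψ s)
    {x y : ℝ} (hx : x ∈ Icc a b) (hy : y ∈ Icc a b) : R y - R x ≤ ψ x * (y - x) := by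
  have hsub : uIcc x y ⊆ Icc a b := uIcc_subset_Icc hx hy
  have hi : IntervalIntegrable ψ volume x y := (hψ.mono hsub).intervalIntegrable
  rw [hR x hx y hy]
  rcases le_total x y with h | h
  · have := intervalIntegral.integral_mono_on h hi (intervalIntegrable_const (c := ψ x))
      fun z hz => hψ hx (hsub (by rwa [uIcc_of_le h])) hz.1
    simpa [mul_comm] using this
  · have := intervalIntegral.integral_mono_on h (intervalIntegrable_const (c := ψ x)) hi.symm
      fun z hz => hψ (hsub (by rwa [uIcc_of_ge h])) hx hz.2
    rw [intervalIntegral.integral_symm]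
    simp only [intervalIntegral.integral_const, smul_eq_mul] at this
    linarith

theorem concaveOn_of_primitive (hψ : AntitoneOn ψ (Icc a b))
    (hR : ∀ x ∈ Icc a b, ∀ y ∈ Icc a b, R y - R x = ∫ s in x..y, ψ s) :
    ConcaveOn ℝ (Icc a b) R := by
  refine ⟨convex_Icc a b, fun x hx y hy p r hp hr hpr => ?_⟩
  have hz := (convex_Icc a b) hx hy hp hr hpr
  have h1 := sub_le_supergradient_mul hψ hR hz hx
  have h2 := sub_le_supergradient_mul hψ hR hz hy
  simp only [smul_eq_mul] at *
  have hr' : r = 1 - p := by linarith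
  subst hr'
  nlinarith [mul_le_mul_of_nonneg_left h1 hp, mul_le_mul_of_nonneg_left h2 hr]

theorem continuousOn_of_primitive (hψ : AntitoneOn ψ (Icc a b))
    (hR : ∀ x ∈ Icc a b, ∀ y ∈ Icc a b, R y - R x = ∫ s in x..y, ψ s) :
    ContinuousOn R (Icc a b) := by
  rcases lt_or_ge b a with h | hab
  · simp [Icc_eq_empty_of_lt h]
  have hi : IntervalIntegrable ψ volume a b := by
    rw [← uIcc_of_le hab] at hψ; exact hψ.intervalIntegrable
  have h := intervalIntegral.continuousOn_primitive_interval (μ := volume) (f := ψ) (a := a) (b := b)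
    (by rw [uIcc_of_le hab]; exact (intervalIntegrable_iff_integrableOn_Icc_of_le hab).1 hi)
  rw [uIcc_of_le hab] at h
  refine (h.const_add (R a)).congr fun x hx => ?_
  have := hR a (left_mem_Icc.2 hab) x hx
  simp only; linarith

/-- The expectation of the one-point estimate of the derivative of `R`. -/
noncomputable def meanGradEstimate (R : ℝ → ℝ) (δ τ : ℝ) : ℝ :=
  2⁻¹ * ∫ u in (-1 : ℝ)..1, R (τ + δ * u) * u / δ

theorem add_mul_mem_Icc {δ τ x : ℝ} (hδ : 0 < δ) (hτ : τ ∈ Icc (a + δ) (b - δ))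
    (hx : x ∈ Icc (-1 : ℝ) 1) : τ + δ * x ∈ Icc a b := by
  have h1 : -δ ≤ δ * x := by nlinarith [hx.1]
  have h2 : δ * x ≤ δ := by nlinarith [hx.2]
  exact ⟨by linarith [hτ.1], by linarith [hτ.2]⟩

theorem continuousOn_comp_add_mul {δ τ : ℝ} (hR : ContinuousOn R (Icc a b)) (hδ : 0 < δ)
    (hτ : τ ∈ Icc (a + δ) (b - δ)) : ContinuousOn (fun x => R (τ + δ * x)) (Icc (-1 : ℝ) 1) :=
  hR.comp (by fun_prop) fun _ hx => add_mul_mem_Icc hδ hτ hx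

/-- The mean of the one-point estimate is a supergradient of a third of the smoothing of `R` with
the kernel `3/4 (1 - x²)`. -/
theorem smoothing_sub_le_meanGradEstimate_mul (hψ : AntitoneOn ψ (Icc a b))
    (hR : ∀ x ∈ Icc a b, ∀ y ∈ Icc a b, R y - R x = ∫ s in x..y, ψ s)
    {δ τ s : ℝ} (hδ : 0 < δ) (hτ : τ ∈ Icc (a + δ) (b - δ)) (hs : s ∈ Icc (a + δ) (b - δ)) :
    4⁻¹ * ((∫ x in (-1 : ℝ)..1, (1 - x ^ 2) * R (s + δ * x)) -
      ∫ x in (-1 : ℝ)..1, (1 - x ^ 2) * R (τ + δ * x)) ≤ meanGradEstimate R δ τ * (s - τ) := by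
  have hcR := continuousOn_of_primitive hψ hR
  have h11 : (-1 : ℝ) ≤ 1 := by norm_num
  have hu : uIcc (-1 : ℝ) 1 = Icc (-1) 1 := uIcc_of_le h11
  have hψi : IntervalIntegrable (fun x => δ * ψ (τ + δ * x)) volume (-1) 1 := by
    have : AntitoneOn (fun x => ψ (τ + δ * x)) (uIcc (-1 : ℝ) 1) := by
      rw [hu]
      intro x hx y hy hxy
      exact hψ (add_mul_mem_Icc hδ hτ hx) (add_mul_mem_Icc hδ hτ hy) (by nlinarith)
    exact this.intervalIntegrable.const_mul δ
  have hprim : ∀ t ∈ Icc (-1 : ℝ) 1, R (τ + δ * t) = R (τ + δ * (-1)) +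
      ∫ x in (-1)..t, δ * ψ (τ + δ * x) := by
    intro t ht
    rw [intervalIntegral.integral_const_mul, intervalIntegral.mul_integral_comp_add_mul,
      ← hR _ (add_mul_mem_Icc hδ hτ ⟨le_rfl, h11⟩) _ (add_mul_mem_Icc hδ hτ ht)]
    ring
  -- The weight `1 - x ^ 2` kills both boundary terms, and its derivative produces the factor `x` of
  -- the estimate.
  have hparts := integral_mul_add_mul_of_primitive (F := fun x => 1 - x ^ 2) (f := fun x => -2 * x)
    (Q := fun x => R (τ + δ * x)) (q := fun x => δ * ψ (τ + δ * x)) h11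
    (Continuous.intervalIntegrable (by fun_prop) _ _) hψi
    (fun t ht => by
      rw [intervalIntegral.integral_const_mul, integral_id]; ring) hprim
  have hIs : IntervalIntegrable (fun x => (1 - x ^ 2) * R (s + δ * x)) volume (-1) 1 :=
    ContinuousOn.intervalIntegrable (by
      rw [hu]; exact ContinuousOn.mul (by fun_prop) (continuousOn_comp_add_mul hcR hδ hs))
  have hcτ := continuousOn_comp_add_mul hcR hδ hτ
  have hIτ : IntervalIntegrable (fun x => (1 - x ^ 2) * R (τ + δ * x)) volume (-1) 1 :=
    ContinuousOn.intervalIntegrable (by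
      rw [hu]; exact ContinuousOn.mul (by fun_prop) hcτ)
  have hI1 : IntervalIntegrable (fun x => -2 * x * R (τ + δ * x)) volume (-1) 1 :=
    ContinuousOn.intervalIntegrable (by
      rw [hu]; exact ContinuousOn.mul (by fun_prop) hcτ)
  have hI2 : IntervalIntegrable (fun x => (1 - x ^ 2) * (δ * ψ (τ + δ * x))) volume (-1) 1 :=
    hψi.continuousOn_mul (by fun_prop)
  rw [intervalIntegral.integral_add hI1 hI2] at hparts
  -- Supergradient inequality at each `τ + δ * x`, compared with `s + δ * x`; the common shift
  -- cancels and leaves `s - τ`.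
  have hmono : (∫ x in (-1 : ℝ)..1, ((1 - x ^ 2) * R (s + δ * x) - (1 - x ^ 2) * R (τ + δ * x))) ≤
      ∫ x in (-1 : ℝ)..1, (s - τ) / δ * ((1 - x ^ 2) * (δ * ψ (τ + δ * x))) := by
    refine intervalIntegral.integral_mono_on h11 (hIs.sub hIτ) (hI2.const_mul _) fun x hx => ?_
    have h := sub_le_supergradient_mul hψ hR (add_mul_mem_Icc hδ hτ hx) (add_mul_mem_Icc hδ hs hx)
    have hx2 : 0 ≤ 1 - x ^ 2 := by nlinarith [hx.1, hx.2]
    have := mul_le_mul_of_nonneg_left h hx2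
    have e : (s - τ) / δ * ((1 - x ^ 2) * (δ * ψ (τ + δ * x))) =
        (1 - x ^ 2) * (ψ (τ + δ * x) * (s + δ * x - (τ + δ * x))) := by
      field_simp; ring
    rw [e]; linarith
  rw [intervalIntegral.integral_sub hIs hIτ, intervalIntegral.integral_const_mul] at hmono
  have e1 : (∫ x in (-1 : ℝ)..1, -2 * x * R (τ + δ * x)) =
      -2 * δ * ∫ x in (-1 : ℝ)..1, R (τ + δ * x) * x / δ := by
    rw [← intervalIntegral.integral_const_mul]
    congr 1; ext x; field_simp
  rw [e1] at hparts
  unfold meanGradEstimate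
  have e2 : (∫ x in (-1 : ℝ)..1, (1 - x ^ 2) * (δ * ψ (τ + δ * x))) =
      2 * δ * ∫ x in (-1 : ℝ)..1, R (τ + δ * x) * x / δ := by linarith
  rw [e2] at hmono
  have e3 : (s - τ) / δ * (2 * δ * ∫ x in (-1 : ℝ)..1, R (τ + δ * x) * x / δ) =
      2 * ((∫ x in (-1 : ℝ)..1, R (τ + δ * x) * x / δ) * (s - τ)) := by field_simp
  rw [e3] at hmono
  linarith

/-- The kernel is even with mass 4/3, so linear terms drop out. This turns pointwise affine bounds
into Jensen-type bounds for the smoothing. -/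
theorem integral_kernel_add_linear (r l : ℝ) :
    ∫ x in (-1 : ℝ)..1, (1 - x ^ 2) * (r + l * x) = 4 / 3 * r := by
  have : (fun x : ℝ => (1 - x ^ 2) * (r + l * x)) =
      fun x => r - r * x ^ 2 + l * x - l * x ^ 3 := by ext; ring
  rw [this, intervalIntegral.integral_sub, intervalIntegral.integral_add,
    intervalIntegral.integral_sub]
  · have h1 : ∫ x in (-1 : ℝ)..1, l * x = 0 := by
      rw [intervalIntegral.integral_const_mul, integral_id]; norm_num
    simp only [h1, intervalIntegral.integral_const_mul, integral_pow,
      intervalIntegral.integral_const, smul_eq_mul]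
    norm_num; ring
  all_goals exact Continuous.intervalIntegrable (by fun_prop) _ _

/-- The regret of `τ` against any threshold is controlled by the mean of the gradient estimate. -/
theorem exists_regret_le_meanGradEstimate_mul (hψ : AntitoneOn ψ (Icc a b))
    (hR : ∀ x ∈ Icc a b, ∀ y ∈ Icc a b, R y - R x = ∫ s in x..y, ψ s)
    {B w δ σ : ℝ} (hR0 : ∀ x ∈ Icc a b, 0 ≤ R x) (hRB : ∀ x ∈ Icc a b, R x ≤ B)
    (hδ : 0 < δ) (hδw : 2 * δ ≤ w) (hw : w ≤ b - a) (hσ : σ ∈ Icc a b) :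
    ∃ s ∈ Icc (a + δ) (b - δ), ∀ τ ∈ Icc (a + δ) (b - δ),
      3⁻¹ * (R σ - 2 * δ / w * B - R τ) ≤ meanGradEstimate R δ τ * (s - τ) := by
  have hw0 : 0 < w := by linarith
  have hcR := continuousOn_of_primitive hψ hR
  have h11 : (-1 : ℝ) ≤ 1 := by norm_num
  have hu : uIcc (-1 : ℝ) 1 = Icc (-1) 1 := uIcc_of_le h11
  -- Moving `σ` towards the midpoint with weight `l` clears a margin `l * (b - a) / 2 ≥ δ` at both
  -- ends.
  set l := 2 * δ / w with hl
  have hl0 : 0 ≤ l := by positivity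
  have hl1 : l ≤ 1 := by rw [hl, div_le_one hw0]; exact hδw
  have hlw : l * w = 2 * δ := by rw [hl]; field_simp
  have hlab : 2 * δ ≤ l * (b - a) := by rw [← hlw]; exact mul_le_mul_of_nonneg_left hw hl0
  have hs : (1 - l) * σ + l * ((a + b) / 2) ∈ Icc (a + δ) (b - δ) := by
    constructor
    · nlinarith [mul_le_mul_of_nonneg_left hσ.1 (sub_nonneg.2 hl1)]
    · nlinarith [mul_le_mul_of_nonneg_left hσ.2 (sub_nonneg.2 hl1)]
  refine ⟨_, hs, fun τ hτ => ?_⟩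
  set s := (1 - l) * σ + l * ((a + b) / 2) with hsdef
  have hkey := smoothing_sub_le_meanGradEstimate_mul hψ hR hδ hτ hs
  have hIs : IntervalIntegrable (fun x => (1 - x ^ 2) * R (s + δ * x)) volume (-1) 1 :=
    ContinuousOn.intervalIntegrable (by
      rw [hu]; exact ContinuousOn.mul (by fun_prop) (continuousOn_comp_add_mul hcR hδ hs))
  have hIτ : IntervalIntegrable (fun x => (1 - x ^ 2) * R (τ + δ * x)) volume (-1) 1 :=
    ContinuousOn.intervalIntegrable (by
      rw [hu]; exact ContinuousOn.mul (by fun_prop) (continuousOn_comp_add_mul hcR hδ hτ))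
  have hτ' : τ ∈ Icc a b := ⟨by linarith [hτ.1], by linarith [hτ.2]⟩
  have h1 : (∫ x in (-1 : ℝ)..1, (1 - x ^ 2) * R (τ + δ * x)) ≤ 4 / 3 * R τ := by
    rw [← integral_kernel_add_linear (R τ) (ψ τ * δ)]
    refine intervalIntegral.integral_mono_on h11 hIτ
      (Continuous.intervalIntegrable (by fun_prop) _ _) fun x hx => ?_
    have h := sub_le_supergradient_mul hψ hR hτ' (add_mul_mem_Icc hδ hτ hx)
    have hx2 : 0 ≤ 1 - x ^ 2 := by nlinarith [hx.1, hx.2]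
    refine mul_le_mul_of_nonneg_left ?_ hx2
    linarith
  have h2 : 4 / 3 * (R σ - l * B) ≤ ∫ x in (-1 : ℝ)..1, (1 - x ^ 2) * R (s + δ * x) := by
    rw [← integral_kernel_add_linear (R σ - l * B) 0]
    refine intervalIntegral.integral_mono_on h11
      (Continuous.intervalIntegrable (by fun_prop) _ _) hIs fun x hx => ?_
    have hx2 : 0 ≤ 1 - x ^ 2 := by nlinarith [hx.1, hx.2]
    refine mul_le_mul_of_nonneg_left ?_ hx2
    have hl0' : 0 < l := by positivity
    -- The perturbed point `s + δ * x` is a combination of `σ` and this point with the same weights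
    -- `1 - l` and `l`; concavity and `0 ≤ R ≤ B` then bound the loss by `l * B`.
    have hm : (a + b) / 2 + δ * x / l ∈ Icc a b := by
      have hd : δ / l ≤ (b - a) / 2 := by
        rw [div_le_iff₀ hl0']; nlinarith
      have hd0 : 0 ≤ δ / l := by positivity
      have e : δ * x / l = δ / l * x := by ring
      rw [e]
      constructor
      · nlinarith [hx.1, mul_le_mul_of_nonneg_left hx.1 hd0]
      · nlinarith [hx.1, mul_le_mul_of_nonneg_left hx.2 hd0]
    have hc := (concaveOn_of_primitive hψ hR).2 hσ hm (sub_nonneg.2 hl1) hl0 (by ring)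
    simp only [smul_eq_mul] at hc
    have e : (1 - l) * σ + l * ((a + b) / 2 + δ * x / l) = s + δ * x := by
      rw [hsdef]; field_simp; ring
    rw [e] at hc
    nlinarith [mul_nonneg hl0 (hR0 _ hm), mul_le_mul_of_nonneg_left (hRB _ hσ) hl0]
  linarith

end Concave

/-! ### Value distributions and the revenue from one buyer -/

namespace Market

variable {n : ℕ} (M : Market n) (i : Fin n)

instance isProbabilityMeasure_extLaw : IsProbabilityMeasure (M.extLaw i) := M.extLaw_prob i

instance isProbabilityMeasure_valueLaw : IsProbabilityMeasure (M.valueLaw i) := by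
  constructor
  rw [valueLaw, withDensity_apply _ MeasurableSet.univ, Measure.restrict_univ]
  exact M.density_total i

instance isProbabilityMeasure_typeLaw : IsProbabilityMeasure M.typeLaw := by
  unfold typeLaw; infer_instance

theorem valueLaw_absolutelyContinuous : M.valueLaw i ≪ volume :=
  (withDensity_absolutelyContinuous _ _).trans Measure.restrict_le_self.absolutelyContinuous

instance nullSingletonClass_valueLaw : NullSingletonClass (M.valueLaw i) :=
  ⟨fun _ => M.valueLaw_absolutelyContinuous i (measure_singleton _)⟩

theorem ae_mem_Icc_valueLaw : ∀ᵐ v ∂M.valueLaw i, v ∈ Icc (M.vlo i) (M.vhi i) :=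
  (withDensity_absolutelyContinuous _ _).ae_le (ae_restrict_mem measurableSet_Icc)

theorem vlo_mem : M.vlo i ∈ Icc (M.vlo i) (M.vhi i) := left_mem_Icc.2 (M.vlo_lt_vhi i).le

theorem vhi_mem : M.vhi i ∈ Icc (M.vlo i) (M.vhi i) := right_mem_Icc.2 (M.vlo_lt_vhi i).le

theorem integrableOn_density : IntegrableOn (M.density i) (Icc (M.vlo i) (M.vhi i)) := by
  refine ⟨(M.density_measurable i).aestronglyMeasurable, ?_⟩
  rw [hasFiniteIntegral_iff_ofReal
    ((ae_restrict_mem measurableSet_Icc).mono fun v hv => M.density_nonneg i v hv),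
    M.density_total i]
  exact ENNReal.one_lt_top

theorem intervalIntegrable_density {x y : ℝ} (hx : x ∈ Icc (M.vlo i) (M.vhi i))
    (hy : y ∈ Icc (M.vlo i) (M.vhi i)) : IntervalIntegrable (M.density i) volume x y :=
  ((M.integrableOn_density i).mono_set (uIcc_subset_Icc hx hy)).intervalIntegrable

/-- Expectations with respect to the law of the value as integrals against the density. -/
theorem integral_valueLaw (h : ℝ → ℝ) :
    ∫ v, h v ∂M.valueLaw i = ∫ v in M.vlo i..M.vhi i, M.density i v * h v := by
  rw [valueLaw, integral_withDensity_eq_integral_toReal_smul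
    (M.density_measurable i).ennreal_ofReal (by simp),
    intervalIntegral.integral_of_le (M.vlo_lt_vhi i).le, ← integral_Icc_eq_integral_Ioc]
  refine setIntegral_congr_fun measurableSet_Icc fun v hv => ?_
  simp [ENNReal.toReal_ofReal (M.density_nonneg i v hv)]

theorem valueCDF_eq_integral {x : ℝ} (hx : x ∈ Icc (M.vlo i) (M.vhi i)) :
    M.valueCDF i x = ∫ v in M.vlo i..x, M.density i v := by
  have h := M.integral_valueLaw i ((Iic x).indicator 1)
  have e : ∀ v, M.density i v * (Iic x).indicator 1 v = (Iic x).indicator (M.density i) v :=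
    fun v => by by_cases hv : v ∈ Iic x <;> simp [indicator, hv]
  simp_rw [e] at h
  rw [integral_indicator_one measurableSet_Iic] at h
  have hi : ∀ y ∈ Icc (M.vlo i) (M.vhi i), ∀ z ∈ Icc (M.vlo i) (M.vhi i),
      IntervalIntegrable ((Iic x).indicator (M.density i)) volume y z := fun y hy z hz => by
    rw [intervalIntegrable_iff]
    exact ((M.integrableOn_density i).mono_set
      (uIoc_subset_uIcc.trans (uIcc_subset_Icc hy hz))).indicator measurableSet_Iic
  rw [valueCDF, h, ← intervalIntegral.integral_add_adjacent_intervals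
    (hi _ (M.vlo_mem i) _ hx) (hi _ hx _ (M.vhi_mem i))]
  have h1 : ∫ v in M.vlo i..x, (Iic x).indicator (M.density i) v =
      ∫ v in M.vlo i..x, M.density i v := by
    refine intervalIntegral.integral_congr fun v hv => ?_
    rw [uIcc_of_le hx.1] at hv
    simp [hv.2]
  have h2 : ∫ v in x..M.vhi i, (Iic x).indicator (M.density i) v = 0 := by
    rw [intervalIntegral.integral_of_le hx.2]
    refine setIntegral_eq_zero_of_forall_eq_zero fun v hv => ?_
    simp [hv.1]
  rw [h1, h2, add_zero]

theorem valueCDF_vhi : M.valueCDF i (M.vhi i) = 1 := by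
  have h := M.integral_valueLaw i (fun _ => 1)
  simp only [integral_const, probReal_univ, smul_eq_mul, mul_one] at h
  rw [M.valueCDF_eq_integral i (M.vhi_mem i), ← h]

theorem valueCDF_nonneg (x : ℝ) : 0 ≤ M.valueCDF i x := measureReal_nonneg

theorem valueCDF_le_one (x : ℝ) : M.valueCDF i x ≤ 1 := measureReal_le_one

theorem monotone_valueCDF : Monotone (M.valueCDF i) := fun _ _ h =>
  measureReal_mono (Iic_subset_Iic.2 h)

theorem valueLaw_real_Ici (x : ℝ) : (M.valueLaw i).real (Ici x) = 1 - M.valueCDF i x := by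
  rw [valueCDF, ← probReal_compl_eq_one_sub measurableSet_Iic, compl_Iic]
  exact measureReal_congr Ioi_ae_eq_Ici.symm

theorem valueCDF_eq_add_integral {x t : ℝ} (hx : x ∈ Icc (M.vlo i) (M.vhi i))
    (ht : t ∈ Icc (M.vlo i) (M.vhi i)) :
    M.valueCDF i t = M.valueCDF i x + ∫ v in x..t, M.density i v := by
  rw [M.valueCDF_eq_integral i hx, M.valueCDF_eq_integral i ht,
    intervalIntegral.integral_add_adjacent_intervals
      (M.intervalIntegrable_density i (M.vlo_mem i) hx) (M.intervalIntegrable_density i hx ht)]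

theorem ae_extLaw_nonneg (j : {j : Fin n // j ≠ i}) : ∀ᵐ η ∂M.extLaw i, 0 ≤ η j :=
  (M.extLaw_range i).mono fun _ hη => (M.etalo_nonneg _ _).trans (hη j).1

theorem integrable_extLaw (j : {j : Fin n // j ≠ i}) : Integrable (fun η => η j) (M.extLaw i) :=
  Integrable.of_mem_Icc (M.etalo j i) (M.etahi j i) (measurable_pi_apply j).aemeasurable
    ((M.extLaw_range i).mono fun _ hη => hη j)

theorem causedExt_nonneg : 0 ≤ M.causedExt i :=
  Finset.sum_nonneg fun j _ => integral_nonneg_of_ae (M.ae_extLaw_nonneg i j)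

/-- Minus the virtual surplus density of the regularity condition. It is the derivative of
`buyerRev`. -/
noncomputable def marginalRev (v : ℝ) : ℝ :=
  -(v * M.density i v - (1 - M.valueCDF i v) - M.density i v * M.causedExt i)

/-- The part of the revenue of a posted-price mechanism that depends on the threshold of
buyer `i`. -/
noncomputable def buyerRev (τ : ℝ) : ℝ := τ * (1 - M.valueCDF i τ) + M.causedExt i * M.valueCDF i τ

variable {M} in
theorem Regular.antitoneOn_marginalRev (hM : M.Regular) :
    AntitoneOn (M.marginalRev i) (Icc (M.vlo i) (M.vhi i)) :=
  (hM i).neg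

/-- The function is v - F(v)(v - c). The density is merely integrable here, so the product is
handled by integration by parts instead of pointwise differentiation. -/
theorem buyerRev_sub_buyerRev_of_le {x y : ℝ} (hx : x ∈ Icc (M.vlo i) (M.vhi i))
    (hy : y ∈ Icc (M.vlo i) (M.vhi i)) (hxy : x ≤ y) :
    M.buyerRev i y - M.buyerRev i x = ∫ v in x..y, M.marginalRev i v := by
  have hsub : ∀ t ∈ Icc x y, t ∈ Icc (M.vlo i) (M.vhi i) := fun t ht =>
    ⟨hx.1.trans ht.1, ht.2.trans hy.2⟩
  have hd := M.intervalIntegrable_density i hx hy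
  have h := integral_mul_add_mul_of_primitive (F := M.valueCDF i) (f := M.density i)
    (Q := fun v => v - M.causedExt i) (q := fun _ => 1) hxy
    hd intervalIntegrable_const
    (fun t ht => M.valueCDF_eq_add_integral i hx (hsub t ht)) (fun t _ => by simp)
  have e : ∀ v, M.marginalRev i v =
      1 - (M.density i v * (v - M.causedExt i) + M.valueCDF i v * 1) := fun v => by
    rw [marginalRev]; ring
  simp_rw [e]
  rw [intervalIntegral.integral_sub intervalIntegrable_const, h]
  · simp [buyerRev]; ring
  · exact (hd.mul_continuousOn (by fun_prop)).add
      ((M.monotone_valueCDF i).intervalIntegrable.mul_continuousOn (by fun_prop))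

theorem buyerRev_sub_buyerRev {x y : ℝ} (hx : x ∈ Icc (M.vlo i) (M.vhi i))
    (hy : y ∈ Icc (M.vlo i) (M.vhi i)) :
    M.buyerRev i y - M.buyerRev i x = ∫ v in x..y, M.marginalRev i v := by
  rcases le_total x y with h | h
  · exact M.buyerRev_sub_buyerRev_of_le i hx hy h
  · rw [intervalIntegral.integral_symm, ← M.buyerRev_sub_buyerRev_of_le i hy hx h]; ring

theorem buyerRev_nonneg {x : ℝ} (hx : x ∈ Icc (M.vlo i) (M.vhi i)) : 0 ≤ M.buyerRev i x :=
  add_nonneg (mul_nonneg ((M.vlo_nonneg i).trans hx.1) (sub_nonneg.2 (M.valueCDF_le_one i x)))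
    (mul_nonneg (M.causedExt_nonneg i) (M.valueCDF_nonneg i x))

theorem buyerRev_le {B x : ℝ} (hB : M.vhi i ≤ B) (hc : M.causedExt i ≤ B)
    (hx : x ∈ Icc (M.vlo i) (M.vhi i)) : M.buyerRev i x ≤ B := by
  have h1 := mul_le_mul_of_nonneg_right (hx.2.trans hB) (sub_nonneg.2 (M.valueCDF_le_one i x))
  have h2 := mul_le_mul_of_nonneg_right hc (M.valueCDF_nonneg i x)
  unfold buyerRev; linarith

theorem measurable_buyerRev : Measurable (M.buyerRev i) := by
  have := (M.monotone_valueCDF i).measurable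
  unfold buyerRev; fun_prop

/-- Summation by buyers of the externalities suffered is summation of the externalities caused. -/
theorem sum_sum_meanExt_mul (a : Fin n → ℝ) :
    ∑ i, ∑ j : {j : Fin n // j ≠ i}, M.meanExt i j * a j = ∑ j, M.causedExt j * a j := by
  have h : ∀ (i : Fin n) (f : Fin n → ℝ),
      ∑ j : {j : Fin n // j ≠ i}, f j = ∑ j, if j ≠ i then f j else 0 := fun i f => by
    rw [← Finset.sum_filter]
    exact (Finset.sum_subtype _ (by simp) f).symm
  -- Extension by zero to the diagonal makes the double sum rectangular, so that the order of
  -- summation can be exchanged.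
  let e : Fin n → Fin n → ℝ := fun i j =>
    if h : i ≠ j then ∫ η, η ⟨i, h⟩ ∂M.extLaw j else 0
  have e1 : ∀ i (j : {j : Fin n // j ≠ i}), M.meanExt i j = e i j := fun i j => by
    simp [e, meanExt, j.2.symm]
  have e2 : ∀ j, M.causedExt j = ∑ i : {i : Fin n // i ≠ j}, e i j := fun j => by
    unfold causedExt
    refine Finset.sum_congr rfl fun i _ => ?_
    simp [e, i.2]
  simp_rw [e1, e2, Finset.sum_mul]
  calc _ = ∑ i, ∑ j, if j ≠ i then e i j * a j else 0 :=
        Finset.sum_congr rfl fun i _ => h i fun j => e i j * a j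
    _ = ∑ j, ∑ i, if j ≠ i then e i j * a j else 0 := Finset.sum_comm
    _ = _ := Finset.sum_congr rfl fun j _ => by
        rw [h j fun i => e i j * a j]
        exact Finset.sum_congr rfl fun i _ => by simp [ne_comm]

theorem measurePreserving_value :
    MeasurePreserving (fun t : Profile n => (t i).1) M.typeLaw (M.valueLaw i) :=
  measurePreserving_fst.comp
    (measurePreserving_eval (fun i => (M.valueLaw i).prod (M.extLaw i)) i)

theorem measurePreserving_ext :
    MeasurePreserving (fun t : Profile n => (t i).2) M.typeLaw (M.extLaw i) :=
  measurePreserving_snd.comp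
    (measurePreserving_eval (fun i => (M.valueLaw i).prod (M.extLaw i)) i)

end Market

/-- By linearity only the probabilities of the events v_j ≥ τ_j matter. Compensations are regrouped
by the buyer who causes them, which yields the term c_j F_j(τ_j). -/
theorem rev_postedPrice {n : ℕ} (M : Market n) (τ : Fin n → ℝ) :
    (postedPrice M τ).rev M = ∑ i, M.buyerRev i (τ i) := by
  have hpay : ∀ (t : Profile n) i, (postedPrice M τ).pay (truthful t) i =
      (Ici (τ i)).indicator 1 (t i).1 * τ i +
        ∑ j : {j : Fin n // j ≠ i}, M.meanExt i j * (1 - (Ici (τ j)).indicator 1 (t j).1) := by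
    intro t i
    simp [postedPrice, truthful, indicator]
  have hint : ∀ j, Integrable (fun t : Profile n => (Ici (τ j)).indicator (1 : ℝ → ℝ) (t j).1)
      M.typeLaw := fun j =>
    (M.measurePreserving_value j).integrable_comp_of_integrable
      ((integrable_const (1 : ℝ)).indicator measurableSet_Ici)
  have hval : ∀ j, ∫ t : Profile n, (Ici (τ j)).indicator (1 : ℝ → ℝ) (t j).1 ∂M.typeLaw =
      1 - M.valueCDF j (τ j) := fun j => by
    rw [← M.valueLaw_real_Ici, ← integral_indicator_one measurableSet_Ici,
      ← (M.measurePreserving_value j).map_eq, integral_map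
        (M.measurePreserving_value j).measurable.aemeasurable
        (measurable_one.indicator measurableSet_Ici).aestronglyMeasurable]
  have hint2 : ∀ i (j : {j : Fin n // j ≠ i}), Integrable (fun t : Profile n =>
      M.meanExt i j * (1 - (Ici (τ j)).indicator (1 : ℝ → ℝ) (t j).1)) M.typeLaw := fun i j =>
    ((integrable_const 1).sub (hint j)).const_mul _
  unfold Mechanism.rev
  simp_rw [hpay]
  have hint3 : ∀ i, Integrable (fun t : Profile n => (Ici (τ i)).indicator 1 (t i).1 * τ i +
      ∑ j : {j : Fin n // j ≠ i}, M.meanExt i j * (1 - (Ici (τ j)).indicator 1 (t j).1))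
      M.typeLaw := fun i =>
    ((hint i).mul_const _).add (integrable_finsetSum _ fun j _ => hint2 i j)
  rw [integral_finsetSum _ fun i _ => hint3 i]
  have h1 : ∀ i, ∫ t : Profile n, ((Ici (τ i)).indicator 1 (t i).1 * τ i +
        ∑ j : {j : Fin n // j ≠ i}, M.meanExt i j * (1 - (Ici (τ j)).indicator 1 (t j).1))
        ∂M.typeLaw = (1 - M.valueCDF i (τ i)) * τ i +
        ∑ j : {j : Fin n // j ≠ i}, M.meanExt i j * M.valueCDF j (τ j) := fun i => by
    rw [integral_add ((hint i).mul_const _) (integrable_finsetSum _ fun j _ => hint2 i j),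
      integral_mul_const, hval, integral_finsetSum _ fun j _ => hint2 i j]
    congr 1
    refine Finset.sum_congr rfl fun j _ => ?_
    rw [integral_const_mul, integral_sub (integrable_const 1) (hint j), hval]
    simp
  simp_rw [h1]
  rw [Finset.sum_add_distrib, M.sum_sum_meanExt_mul fun j => M.valueCDF j (τ j),
    ← Finset.sum_add_distrib]
  exact Finset.sum_congr rfl fun i _ => by rw [Market.buyerRev]; ring

/-! ### Recursions driven by independent innovations -/

section Recursion

variable {Ω α β : Type*} [MeasurableSpace α] [MeasurableSpace β]
  {W : ℕ → Ω → α} {T : ℕ → Ω → β} {step : β × α → β} {x₀ : β}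

theorem exists_measurable_comp_of_recursion (hstep : Measurable step) (hT0 : ∀ ω, T 0 ω = x₀)
    (hTs : ∀ k ω, T (k + 1) ω = step (T k ω, W k ω)) (k : ℕ) :
    ∃ φ : (Finset.range k → α) → β, Measurable φ ∧ ∀ ω, T k ω = φ fun j => W j ω := by
  induction k with
  | zero => exact ⟨fun _ => x₀, measurable_const, hT0⟩
  | succ k ih =>
    obtain ⟨φ, hφ, h⟩ := ih
    refine ⟨fun x => step (φ fun j => x ⟨j, Finset.range_mono k.le_succ j.2⟩,
      x ⟨k, Finset.self_mem_range_succ k⟩), ?_, fun ω => ?_⟩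
    · exact hstep.comp ((hφ.comp (measurable_pi_lambda _ fun j => measurable_pi_apply _)).prodMk
        (measurable_pi_apply _))
    · rw [hTs, h]

variable [MeasurableSpace Ω] {P : Measure Ω}

theorem measurable_of_recursion (hstep : Measurable step) (hW : ∀ k, Measurable (W k))
    (hT0 : ∀ ω, T 0 ω = x₀) (hTs : ∀ k ω, T (k + 1) ω = step (T k ω, W k ω)) (k : ℕ) :
    Measurable (T k) := by
  obtain ⟨φ, hφ, h⟩ := exists_measurable_comp_of_recursion hstep hT0 hTs k
  rw [funext h]
  exact hφ.comp (measurable_pi_lambda _ fun j => hW j)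

/-- The state at time `k` is a function of the innovations with index below `k`, hence independent
of the one used in the next update. -/
theorem indepFun_of_recursion (hstep : Measurable step) (hW : ∀ k, Measurable (W k))
    (hind : iIndepFun W P) (hT0 : ∀ ω, T 0 ω = x₀)
    (hTs : ∀ k ω, T (k + 1) ω = step (T k ω, W k ω)) (k : ℕ) : IndepFun (T k) (W k) P := by
  obtain ⟨φ, hφ, h⟩ := exists_measurable_comp_of_recursion hstep hT0 hTs k
  rw [funext h]
  have := hind.indepFun_finset (Finset.range k) {k} (by simp) hW
  exact this.comp hφ (measurable_pi_apply (⟨k, Finset.mem_singleton_self k⟩ : ({k} : Finset ℕ)))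

/-- Integration of a function of independent variables, first with respect to the second one. -/
theorem integral_comp_of_indepFun [IsProbabilityMeasure P] {X : Ω → β} {Y : Ω → α}
    {ν : Measure α} (hX : Measurable X)
    (hY : Measurable Y) (h : IndepFun X Y P) (hν : P.map Y = ν) {g : β × α → ℝ}
    (hg : Measurable g) (hgi : Integrable (fun ω => g (X ω, Y ω)) P) :
    ∫ ω, g (X ω, Y ω) ∂P = ∫ ω, ∫ y, g (X ω, y) ∂ν ∂P := by
  have : IsProbabilityMeasure (P.map Y) := Measure.isProbabilityMeasure_map hY.aemeasurable
  have : IsProbabilityMeasure (P.map X) := Measure.isProbabilityMeasure_map hX.aemeasurable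
  subst hν
  have hmap := (indepFun_iff_map_prod_eq_prod_map_map hX.aemeasurable hY.aemeasurable).1 h
  have hi : Integrable g ((P.map X).prod (P.map Y)) := by
    rw [← hmap]
    exact (integrable_map_measure hg.aestronglyMeasurable (hX.prodMk hY).aemeasurable).2 hgi
  calc ∫ ω, g (X ω, Y ω) ∂P = ∫ z, g z ∂(P.map fun ω => (X ω, Y ω)) :=
        (integral_map (hX.prodMk hY).aemeasurable hg.aestronglyMeasurable).symm
    _ = ∫ x, ∫ y, g (x, y) ∂(P.map Y) ∂(P.map X) := by rw [hmap, integral_prod _ hi]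
    _ = _ := integral_map hX.aemeasurable
        (hg.stronglyMeasurable.integral_prod_right' (ν := P.map Y)).aestronglyMeasurable

end Recursion

/-! ### Stochastic gradient ascent for one buyer -/

/-- The law of the noise of one buyer. -/
noncomputable abbrev uniformNoise : Measure ℝ := cond volume (Icc (-1 : ℝ) 1)

instance isProbabilityMeasure_uniformNoise : IsProbabilityMeasure uniformNoise :=
  cond_isProbabilityMeasure_of_finite (by simp) (by simp)

theorem integral_uniformNoise (h : ℝ → ℝ) :
    ∫ u, h u ∂uniformNoise = 2⁻¹ * ∫ u in (-1 : ℝ)..1, h u := by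
  rw [uniformNoise, ProbabilityTheory.cond, integral_smul_measure,
    intervalIntegral.integral_of_le (by norm_num), integral_Icc_eq_integral_Ioc]
  congr 1
  rw [Real.volume_Icc, ENNReal.toReal_inv, ENNReal.toReal_ofReal (by norm_num)]
  norm_num

theorem ae_uniformNoise_mem : ∀ᵐ u ∂uniformNoise, u ∈ Icc (-1 : ℝ) 1 :=
  ae_cond_mem measurableSet_Icc

namespace Market

variable {n : ℕ} (M : Market n) (i : Fin n)

theorem measurable_revEstimate : Measurable fun z : ℝ × ℝ => revEstimate M i z.1 z.2 := by
  unfold revEstimate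
  have : Measurable fun z : ℝ × ℝ => if z.1 ≤ z.2 then (1 : ℝ) else 0 :=
    Measurable.ite (measurableSet_le measurable_fst measurable_snd) measurable_const
      measurable_const
  fun_prop

theorem revEstimate_mem {B p v : ℝ} (hB : M.vhi i ≤ B) (hc : M.causedExt i ≤ B)
    (hp : p ∈ Icc (M.vlo i) (M.vhi i)) : revEstimate M i p v ∈ Icc 0 B := by
  unfold revEstimate
  split_ifs
  · exact ⟨by linarith [hp.1, M.vlo_nonneg i], by linarith [hp.2]⟩
  · exact ⟨by linarith [M.causedExt_nonneg i], by linarith⟩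

/-- The estimate equals `p` on a sale and the caused externality otherwise, so it is unbiased for
the revenue at the posted price. -/
theorem integral_revEstimate (p : ℝ) :
    ∫ v, revEstimate M i p v ∂M.valueLaw i = M.buyerRev i p := by
  have e : ∀ v, revEstimate M i p v =
      M.causedExt i + (Ici p).indicator 1 v * (p - M.causedExt i) := fun v => by
    by_cases h : p ≤ v <;> simp [revEstimate, indicator, h]
  simp_rw [e]
  have hi : Integrable (fun v => (Ici p).indicator (1 : ℝ → ℝ) v * (p - M.causedExt i))
      (M.valueLaw i) := ((integrable_const (1 : ℝ)).indicator measurableSet_Ici).mul_const _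
  rw [integral_add (integrable_const _) hi, integral_mul_const,
    integral_indicator_one measurableSet_Ici, M.valueLaw_real_Ici, buyerRev]
  simp; ring

/-- The update of the threshold of buyer `i`, given her value and the noise. -/
noncomputable def stepThreshold (δ γ : ℝ) (z : ℝ × ℝ × ℝ) : ℝ :=
  max (M.vlo i + δ) (min (M.vhi i - δ)
    (z.1 + γ * (revEstimate M i (z.1 + δ * z.2.2) z.2.1 * z.2.2 / δ)))

theorem measurable_gradEstimate (δ : ℝ) : Measurable fun z : ℝ × ℝ × ℝ =>
    revEstimate M i (z.1 + δ * z.2.2) z.2.1 * z.2.2 / δ := by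
  have h : Measurable fun z : ℝ × ℝ × ℝ => revEstimate M i (z.1 + δ * z.2.2) z.2.1 :=
    (M.measurable_revEstimate i).comp
      (f := fun z : ℝ × ℝ × ℝ => (z.1 + δ * z.2.2, z.2.1)) (by fun_prop)
  fun_prop

theorem measurable_stepThreshold (δ γ : ℝ) : Measurable (M.stepThreshold i δ γ) := by
  have := M.measurable_gradEstimate i δ
  unfold stepThreshold
  fun_prop

theorem stepThreshold_mem {δ γ : ℝ} (h : 2 * δ ≤ M.vhi i - M.vlo i) (z : ℝ × ℝ × ℝ) :
    M.stepThreshold i δ γ z ∈ Icc (M.vlo i + δ) (M.vhi i - δ) :=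
  ⟨le_max_left _ _, max_le (by linarith) (min_le_left _ _)⟩

theorem abs_gradEstimate_le {B δ x v u : ℝ} (hB : M.vhi i ≤ B) (hc : M.causedExt i ≤ B)
    (hδ : 0 < δ) (hx : x ∈ Icc (M.vlo i + δ) (M.vhi i - δ)) (hu : u ∈ Icc (-1 : ℝ) 1) :
    |revEstimate M i (x + δ * u) v * u / δ| ≤ B / δ := by
  have h := M.revEstimate_mem i (v := v) hB hc (add_mul_mem_Icc hδ hx hu)
  rw [abs_div, abs_of_pos hδ, abs_mul, abs_of_nonneg h.1]
  have : |u| ≤ 1 := abs_le.2 hu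
  exact div_le_div_of_nonneg_right
    ((mul_le_of_le_one_right h.1 this).trans h.2) hδ.le

theorem integral_gradEstimate {B δ x : ℝ} (hB : M.vhi i ≤ B) (hc : M.causedExt i ≤ B)
    (hδ : 0 < δ) (hx : x ∈ Icc (M.vlo i + δ) (M.vhi i - δ)) :
    ∫ y, revEstimate M i (x + δ * y.2) y.1 * y.2 / δ ∂(M.valueLaw i).prod uniformNoise =
      meanGradEstimate (M.buyerRev i) δ x := by
  have hae : ∀ᵐ y ∂(M.valueLaw i).prod uniformNoise, y.2 ∈ Icc (-1 : ℝ) 1 :=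
    Measure.quasiMeasurePreserving_snd.ae ae_uniformNoise_mem
  have hi : Integrable (fun y : ℝ × ℝ => revEstimate M i (x + δ * y.2) y.1 * y.2 / δ)
      ((M.valueLaw i).prod uniformNoise) := by
    refine Integrable.of_bound (C := B / δ)
      ((M.measurable_gradEstimate i δ).comp (measurable_const.prodMk measurable_id :
        Measurable fun y : ℝ × ℝ => (x, y))).aestronglyMeasurable ?_
    filter_upwards [hae] with y hy
    exact M.abs_gradEstimate_le i hB hc hδ hx hy
  -- The value is averaged out first, at fixed noise, where the estimate is unbiased.
  rw [integral_prod_symm _ hi, meanGradEstimate, ← integral_uniformNoise]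
  refine integral_congr_ae (Filter.Eventually.of_forall fun u => ?_)
  simp only
  rw [integral_div, integral_mul_const, integral_revEstimate]

theorem sq_stepThreshold_sub_le {B δ γ x s v u : ℝ} (hB : M.vhi i ≤ B) (hc : M.causedExt i ≤ B)
    (hδ : 0 < δ) (hx : x ∈ Icc (M.vlo i + δ) (M.vhi i - δ))
    (hs : s ∈ Icc (M.vlo i + δ) (M.vhi i - δ)) (hu : u ∈ Icc (-1 : ℝ) 1) :
    (M.stepThreshold i δ γ (x, v, u) - s) ^ 2 ≤ (x - s) ^ 2 -
      2 * γ * ((s - x) * (revEstimate M i (x + δ * u) v * u / δ)) + γ ^ 2 * (B / δ) ^ 2 := by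
  have h1 := M.abs_gradEstimate_le i (v := v) hB hc hδ hx hu
  unfold stepThreshold
  simp only
  set g := revEstimate M i (x + δ * u) v * u / δ with hg
  -- Projection onto an interval containing `s` does not increase the distance to `s`.
  have hproj : (max (M.vlo i + δ) (min (M.vhi i - δ) (x + γ * g)) - s) ^ 2 ≤
      (x + γ * g - s) ^ 2 := by
    rw [sq_le_sq]
    obtain ⟨hs1, hs2⟩ := hs
    rcases le_total (M.vhi i - δ) (x + γ * g) with h | h
    · rw [min_eq_left h, max_eq_right (hs1.trans hs2), abs_of_nonneg (by linarith),
        abs_of_nonneg (by linarith)]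
      linarith
    · rw [min_eq_right h]
      rcases le_total (M.vlo i + δ) (x + γ * g) with h' | h'
      · rw [max_eq_right h']
      · rw [max_eq_left h', abs_of_nonpos (by linarith), abs_of_nonpos (by linarith)]
        linarith
  have hsq : g ^ 2 ≤ (B / δ) ^ 2 := sq_le_sq' (by linarith [abs_le.1 h1]) (abs_le.1 h1).2
  nlinarith [mul_le_mul_of_nonneg_left hsq (sq_nonneg γ)]

section Regret

variable {Ω : Type*} {W : ℕ → Ω → ℝ × ℝ} {T : ℕ → Ω → ℝ} {x₀ B δ γ w σ : ℝ}

theorem thresholds_mem (hδ : 0 < δ) (hδw : 2 * δ ≤ M.vhi i - M.vlo i)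
    (hx₀ : x₀ ∈ Icc (M.vlo i) (M.vhi i)) (hT0 : ∀ ω, T 0 ω = x₀)
    (hTs : ∀ k ω, T (k + 1) ω = M.stepThreshold i δ γ (T k ω, W k ω)) (k : ℕ) (ω : Ω) :
    T k ω ∈ Icc (M.vlo i) (M.vhi i) := by
  cases k with
  | zero => rwa [hT0]
  | succ k =>
    rw [hTs]
    have := M.stepThreshold_mem i (γ := γ) hδw (T k ω, W k ω)
    exact ⟨by linarith [this.1], by linarith [this.2]⟩

variable [MeasurableSpace Ω] {P : Measure Ω} [IsProbabilityMeasure P]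

theorem average_mem {K : ℕ} (hK : 1 ≤ K) {a b : ℝ} {x : ℕ → ℝ} (hx : ∀ k, x k ∈ Icc a b) :
    (∑ k ∈ Finset.range K, x k) / K ∈ Icc a b := by
  have hK0 : (0 : ℝ) < K := by exact_mod_cast hK
  have h1 := Finset.card_nsmul_le_sum (Finset.range K) x a fun k _ => (hx k).1
  have h2 := Finset.sum_le_card_nsmul (Finset.range K) x b fun k _ => (hx k).2
  simp only [Finset.card_range, nsmul_eq_mul] at h1 h2
  exact ⟨by rw [le_div_iff₀ hK0]; linarith, by rw [div_le_iff₀ hK0]; linarith⟩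

theorem integrable_buyerRev {X : Ω → ℝ} (hX : Measurable X)
    (hB : M.vhi i ≤ B) (hc : M.causedExt i ≤ B) (hmem : ∀ ω, X ω ∈ Icc (M.vlo i) (M.vhi i)) :
    Integrable (fun ω => M.buyerRev i (X ω)) P :=
  Integrable.of_mem_Icc 0 B ((M.measurable_buyerRev i).comp hX).aemeasurable
    (Filter.Eventually.of_forall fun ω =>
      ⟨M.buyerRev_nonneg i (hmem ω), M.buyerRev_le i hB hc (hmem ω)⟩)

/-- The expected progress of one step of stochastic gradient ascent. -/
theorem integral_sq_step_le (hB : M.vhi i ≤ B) (hc : M.causedExt i ≤ B)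
    (hδ : 0 < δ) (hγ : 0 < γ)
    {X : Ω → ℝ} {Y : Ω → ℝ × ℝ} (hX : Measurable X) (hY : Measurable Y) (hXY : IndepFun X Y P)
    (hlaw : P.map Y = (M.valueLaw i).prod uniformNoise)
    (hXm : ∀ ω, X ω ∈ Icc (M.vlo i + δ) (M.vhi i - δ)) {s r : ℝ}
    (hs : s ∈ Icc (M.vlo i + δ) (M.vhi i - δ))
    (hreg : ∀ τ ∈ Icc (M.vlo i + δ) (M.vhi i - δ),
      3⁻¹ * (r - M.buyerRev i τ) ≤ meanGradEstimate (M.buyerRev i) δ τ * (s - τ)) :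
    ∫ ω, (M.stepThreshold i δ γ (X ω, Y ω) - s) ^ 2 ∂P ≤ ∫ ω, (X ω - s) ^ 2 ∂P -
      2 * γ * (3⁻¹ * (r - ∫ ω, M.buyerRev i (X ω) ∂P)) + γ ^ 2 * (B / δ) ^ 2 := by
  have hXm' : ∀ ω, X ω ∈ Icc (M.vlo i) (M.vhi i) := fun ω =>
    ⟨by linarith [(hXm ω).1], by linarith [(hXm ω).2]⟩
  have hRi := M.integrable_buyerRev i (P := P) hX hB hc hXm'
  have hYae : ∀ᵐ ω ∂P, (Y ω).2 ∈ Icc (-1 : ℝ) 1 := by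
    have : ∀ᵐ y ∂P.map Y, y.2 ∈ Icc (-1 : ℝ) 1 := by
      rw [hlaw]; exact Measure.quasiMeasurePreserving_snd.ae ae_uniformNoise_mem
    exact ae_of_ae_map hY.aemeasurable this
  let g : ℝ × ℝ × ℝ → ℝ := fun z => (s - z.1) * (revEstimate M i (z.1 + δ * z.2.2) z.2.1 * z.2.2 / δ)
  have hg : Measurable g :=
    (measurable_const.sub measurable_fst).mul (M.measurable_gradEstimate i δ)
  have hD : ∀ x ∈ Icc (M.vlo i + δ) (M.vhi i - δ), |s - x| ≤ M.vhi i - M.vlo i := fun x hx => by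
    rw [abs_le]; constructor <;> linarith [hx.1, hx.2, hs.1, hs.2]
  have hgi : Integrable (fun ω => g (X ω, Y ω)) P := by
    refine Integrable.of_bound (C := (M.vhi i - M.vlo i) * (B / δ))
      (hg.comp (hX.prodMk hY)).aestronglyMeasurable ?_
    filter_upwards [hYae] with ω hω
    rw [Real.norm_eq_abs, abs_mul]
    exact mul_le_mul (hD _ (hXm ω)) (M.abs_gradEstimate_le i hB hc hδ (hXm ω) hω)
      (abs_nonneg _) (sub_nonneg.2 (M.vlo_lt_vhi i).le)
  have hsq : ∀ Z : Ω → ℝ, Measurable Z → (∀ ω, Z ω ∈ Icc (M.vlo i + δ) (M.vhi i - δ)) →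
      Integrable (fun ω => (Z ω - s) ^ 2) P := fun Z hZ hZm =>
    Integrable.of_mem_Icc 0 ((M.vhi i - M.vlo i) ^ 2) (by fun_prop)
      (Filter.Eventually.of_forall fun ω => ⟨sq_nonneg _, by
        have := hD _ (hZm ω)
        rw [abs_sub_comm] at this
        exact sq_le_sq' (by linarith [abs_le.1 this]) (abs_le.1 this).2⟩)
  -- Independence allows averaging over `Y` with `X` frozen; `hreg` applies to the inner mean.
  have hmean : 3⁻¹ * (r - ∫ ω, M.buyerRev i (X ω) ∂P) ≤ ∫ ω, g (X ω, Y ω) ∂P := by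
    have hin : ∀ ω, ∫ y, g (X ω, y) ∂(M.valueLaw i).prod uniformNoise =
        (s - X ω) * meanGradEstimate (M.buyerRev i) δ (X ω) := fun ω => by
      simp only [g]
      rw [integral_const_mul, M.integral_gradEstimate i hB hc hδ (hXm ω)]
    have hmap := (indepFun_iff_map_prod_eq_prod_map_map hX.aemeasurable hY.aemeasurable).1 hXY
    have : IsProbabilityMeasure (P.map X) := Measure.isProbabilityMeasure_map hX.aemeasurable
    have hint : Integrable (fun ω => ∫ y, g (X ω, y) ∂(M.valueLaw i).prod uniformNoise) P := by
      have h1 : Integrable g ((P.map X).prod ((M.valueLaw i).prod uniformNoise)) := by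
        rw [← hlaw, ← hmap]
        exact (integrable_map_measure hg.aestronglyMeasurable (hX.prodMk hY).aemeasurable).2 hgi
      exact h1.integral_prod_left.comp_measurable hX
    rw [integral_comp_of_indepFun hX hY hXY hlaw hg hgi]
    calc 3⁻¹ * (r - ∫ ω, M.buyerRev i (X ω) ∂P)
        = ∫ ω, 3⁻¹ * (r - M.buyerRev i (X ω)) ∂P := by
          rw [integral_const_mul, integral_sub (integrable_const _) hRi]; simp
      _ ≤ _ := by
          refine integral_mono (((integrable_const _).sub hRi).const_mul _) hint fun ω => ?_
          simp only
          rw [hin, mul_comm (s - X ω)]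
          exact hreg _ (hXm ω)
  have hstep : ∫ ω, (M.stepThreshold i δ γ (X ω, Y ω) - s) ^ 2 ∂P ≤
      ∫ ω, ((X ω - s) ^ 2 - 2 * γ * g (X ω, Y ω) + γ ^ 2 * (B / δ) ^ 2) ∂P := by
    refine integral_mono_ae (hsq _ ((M.measurable_stepThreshold i δ γ).comp (hX.prodMk hY))
      fun ω => M.stepThreshold_mem i (by linarith [hs.1, hs.2]) _)
      (((hsq X hX hXm).sub (hgi.const_mul _)).add (integrable_const _)) ?_
    filter_upwards [hYae] with ω hω
    exact M.sq_stepThreshold_sub_le i hB hc hδ (hXm ω) hs hω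
  have hdi : Integrable (fun ω => (X ω - s) ^ 2 - 2 * γ * g (X ω, Y ω)) P :=
    (hsq X hX hXm).sub (hgi.const_mul _)
  rw [integral_add hdi (integrable_const _), integral_sub (hsq X hX hXm) (hgi.const_mul _), integral_const_mul] at hstep
  simp only [integral_const, probReal_univ, smul_eq_mul, one_mul] at hstep
  nlinarith

/-- The regret of the average threshold of one buyer. -/
theorem buyerRev_sub_integral_average_le (hM : M.Regular) (hB : M.vhi i ≤ B)
    (hc : M.causedExt i ≤ B) (hδ : 0 < δ) (hγ : 0 < γ) (hδw : 2 * δ ≤ w)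
    (hw : w ≤ M.vhi i - M.vlo i) (hx₀ : x₀ ∈ Icc (M.vlo i) (M.vhi i))
    (hW : ∀ k, Measurable (W k)) (hind : iIndepFun W P)
    (hlaw : ∀ k, P.map (W k) = (M.valueLaw i).prod uniformNoise)
    (hT0 : ∀ ω, T 0 ω = x₀) (hTs : ∀ k ω, T (k + 1) ω = M.stepThreshold i δ γ (T k ω, W k ω))
    {K : ℕ} (hK : 1 ≤ K) (hσ : σ ∈ Icc (M.vlo i) (M.vhi i)) :
    M.buyerRev i σ - ∫ ω, M.buyerRev i ((∑ k ∈ Finset.range K, T k ω) / K) ∂P ≤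
      2 * δ / w * B + 3 * B ^ 2 / (2 * γ * K) + 3 * γ * B ^ 2 / (2 * δ ^ 2) + B / K := by
  have hstep := M.measurable_stepThreshold i δ γ
  have hTm := measurable_of_recursion hstep hW hT0 hTs
  have hTind := indepFun_of_recursion hstep hW hind hT0 hTs
  have hmem := M.thresholds_mem i hδ (hδw.trans hw) hx₀ hT0 hTs
  have hmem' : ∀ k ω, T (k + 1) ω ∈ Icc (M.vlo i + δ) (M.vhi i - δ) := fun k ω => by
    rw [hTs]; exact M.stepThreshold_mem i (hδw.trans hw) _
  have hK0 : (0 : ℝ) < K := by exact_mod_cast hK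
  have hw0 : 0 < w := by linarith
  have hB0 : 0 ≤ B := (M.vlo_nonneg i).trans ((M.vlo_lt_vhi i).le.trans hB)
  obtain ⟨s, hs, hreg⟩ := exists_regret_le_meanGradEstimate_mul (hM.antitoneOn_marginalRev i)
    (fun x hx y hy => M.buyerRev_sub_buyerRev i hx hy) (fun x hx => M.buyerRev_nonneg i hx)
    (fun x hx => M.buyerRev_le i hB hc hx) hδ hδw hw hσ
  set r := M.buyerRev i σ - 2 * δ / w * B with hr
  -- The index starts at 1, since the initial threshold may lie outside the shrunken interval on
  -- which the estimate is controlled.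
  have hone : ∀ k, ∫ ω, (T (k + 2) ω - s) ^ 2 ∂P ≤ ∫ ω, (T (k + 1) ω - s) ^ 2 ∂P -
      2 * γ * (3⁻¹ * (r - ∫ ω, M.buyerRev i (T (k + 1) ω) ∂P)) + γ ^ 2 * (B / δ) ^ 2 := fun k => by
    simp_rw [hTs (k + 1)]
    exact M.integral_sq_step_le i hB hc hδ hγ (hTm _) (hW _) (hTind _) (hlaw _) (hmem' k) hs hreg
  have hsum : ∀ m : ℕ, ∫ ω, (T (m + 1) ω - s) ^ 2 ∂P ≤ B ^ 2 -
      2 * γ * 3⁻¹ * ∑ k ∈ Finset.range m, (r - ∫ ω, M.buyerRev i (T (k + 1) ω) ∂P) +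
      m * (γ ^ 2 * (B / δ) ^ 2) := by
    intro m
    induction m with
    | zero =>
      have : ∫ ω, (T 1 ω - s) ^ 2 ∂P ≤ ∫ _ω, B ^ 2 ∂P := by
        refine integral_mono_of_nonneg (Filter.Eventually.of_forall fun ω => sq_nonneg _)
          (integrable_const _) (Filter.Eventually.of_forall fun ω => ?_)
        have h1 := hmem' 0 ω
        have h2 := M.vlo_nonneg i
        exact sq_le_sq' (by linarith [h1.1, h1.2, hs.1, hs.2])
          (by linarith [h1.1, h1.2, hs.1, hs.2])
      simpa using this
    | succ m ih =>
      rw [Finset.sum_range_succ]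
      have := hone m
      push_cast
      linarith
  obtain ⟨m, rfl⟩ : ∃ m, K = m + 1 := ⟨K - 1, by omega⟩
  have hRi : ∀ k, Integrable (fun ω => M.buyerRev i (T k ω)) P := fun k =>
    M.integrable_buyerRev i (hTm k) hB hc (hmem k)
  -- Concavity passes from the average revenue to the revenue at the average threshold.
  have hconc : (∑ k ∈ Finset.range (m + 1), ∫ ω, M.buyerRev i (T k ω) ∂P) / (m + 1 : ℕ) ≤
      ∫ ω, M.buyerRev i ((∑ k ∈ Finset.range (m + 1), T k ω) / (m + 1 : ℕ)) ∂P := by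
    rw [← integral_finsetSum _ fun k _ => hRi k, ← integral_div]
    refine integral_mono ((integrable_finsetSum _ fun k _ => hRi k).div_const _)
      (M.integrable_buyerRev i ((Finset.measurable_sum _ fun k _ => hTm k).div_const _) hB hc
        fun ω => average_mem hK fun k => hmem k ω) fun ω => ?_
    have h := (concaveOn_of_primitive (hM.antitoneOn_marginalRev i)
      (fun x hx y hy => M.buyerRev_sub_buyerRev i hx hy)).le_map_sum
      (t := Finset.range (m + 1)) (w := fun _ => ((m + 1 : ℕ) : ℝ)⁻¹) (p := fun k => T k ω)
      (fun _ _ => by positivity) (by simp; field_simp) fun k _ => hmem k ω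
    simp only [smul_eq_mul, ← Finset.mul_sum] at h
    simpa only [div_eq_inv_mul] using h
  have hR0 : 0 ≤ ∫ ω, M.buyerRev i (T 0 ω) ∂P :=
    integral_nonneg fun ω => M.buyerRev_nonneg i (hmem 0 ω)
  rw [Finset.sum_range_succ'] at hconc
  have h0 : 0 ≤ ∫ ω, (T (m + 1) ω - s) ^ 2 ∂P := integral_nonneg fun ω => sq_nonneg _
  have h1 := h0.trans (hsum m)
  rw [Finset.sum_sub_distrib, Finset.sum_const, Finset.card_range, nsmul_eq_mul] at h1
  set S := ∑ k ∈ Finset.range m, ∫ ω, M.buyerRev i (T (k + 1) ω) ∂P with hS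
  have hσB := M.buyerRev_le i hB hc hσ
  have hmK : ((m + 1 : ℕ) : ℝ) = m + 1 := by push_cast; ring
  have h2 : m * r - S ≤ 3 * B ^ 2 / (2 * γ) + m * (3 * γ * B ^ 2 / (2 * δ ^ 2)) := by
    have e : 3 * B ^ 2 / (2 * γ) + m * (3 * γ * B ^ 2 / (2 * δ ^ 2)) =
        (B ^ 2 + m * (γ ^ 2 * (B / δ) ^ 2)) / (2 * γ * 3⁻¹) := by field_simp
    rw [e, le_div_iff₀ (by positivity)]
    linarith
  -- The uncontrolled first round costs at most `B`, as revenues lie in [0, B].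
  have h3 : (m + 1 : ℝ) * M.buyerRev i σ - (S + ∫ ω, M.buyerRev i (T 0 ω) ∂P) ≤
      (m + 1) * (2 * δ / w * B) + 3 * B ^ 2 / (2 * γ) + (m + 1) * (3 * γ * B ^ 2 / (2 * δ ^ 2))
        + B := by
    have p1 : 0 ≤ 2 * δ / w * B := by positivity
    have p2 : 0 ≤ 3 * γ * B ^ 2 / (2 * δ ^ 2) := by positivity
    rw [hr] at h2
    linarith
  refine (sub_le_sub_left hconc _).trans ?_
  rw [hmK] at hK0 ⊢
  have e1 : M.buyerRev i σ - (S + ∫ ω, M.buyerRev i (T 0 ω) ∂P) / (m + 1) =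
      ((m + 1 : ℝ) * M.buyerRev i σ - (S + ∫ ω, M.buyerRev i (T 0 ω) ∂P)) / (m + 1) := by
    field_simp
  rw [e1, div_le_iff₀ hK0]
  refine h3.trans (le_of_eq ?_)
  field_simp

end Regret

end Market

/-! ### Interim quantities and the optimality of thresholds -/

theorem truthful_update {n : ℕ} (t : Profile n) (i : Fin n) (s : BidderType n i) :
    truthful (Function.update t i s) = Function.update (truthful t) i (some s) := by
  ext1 j
  by_cases h : j = i
  · subst h; simp [truthful]
  · simp [truthful, h]

/-- What buyer `i` suffers is recorded in the types of the others. This is why her own externality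
report is irrelevant to her utility except through the mechanism. -/
theorem externality_update {n : ℕ} (t : Profile n) (i : Fin n) (s : BidderType n i)
    (j : {j : Fin n // j ≠ i}) :
    externality (Function.update t i s) i j = externality t i j := by
  simp [externality, Function.update_of_ne j.2]

/-- A value between the left and right limits of a monotone function at a continuity point. -/
theorem eq_of_continuousWithinAt_of_between {q : ℝ → ℝ} {a b v x : ℝ} (hv : v ∈ Ioo a b)
    (hc : ContinuousWithinAt q (Icc a b) v) (h1 : ∀ y ∈ Icc a b, v < y → x ≤ q y)
    (h2 : ∀ y ∈ Icc a b, y < v → q y ≤ x) : x = q v := by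
  have hc' : ContinuousAt q v := hc.continuousAt (Icc_mem_nhds hv.1 hv.2)
  refine le_antisymm ?_ ?_
  · refine ge_of_tendsto (hc'.tendsto.mono_left nhdsWithin_le_nhds : Filter.Tendsto q
      (nhdsWithin v (Ioi v)) (nhds (q v))) ?_
    filter_upwards [Ioo_mem_nhdsGT hv.2] with y hy
    exact h1 y ⟨(hv.1.trans hy.1).le, hy.2.le⟩ hy.1
  · refine le_of_tendsto (hc'.tendsto.mono_left nhdsWithin_le_nhds : Filter.Tendsto q
      (nhdsWithin v (Iio v)) (nhds (q v))) ?_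
    filter_upwards [Ioo_mem_nhdsLT hv.1] with y hy
    exact h2 y ⟨hy.1.le, (hy.2.trans hv.2).le⟩ hy.2

namespace Market

variable {n : ℕ} (M : Market n) (i : Fin n)

/-- Resampling one coordinate independently preserves a product law; interim expectations can thus
be averaged back to ex ante ones. -/
theorem measurePreserving_update :
    MeasurePreserving (fun z : BidderType n i × Profile n => Function.update z.2 i z.1)
      (((M.valueLaw i).prod (M.extLaw i)).prod M.typeLaw) M.typeLaw := by
  have hm : Measurable fun z : BidderType n i × Profile n => Function.update z.2 i z.1 := by
    rw [measurable_pi_iff]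
    intro j
    by_cases h : j = i
    · subst h; simpa using measurable_fst
    · simpa [h, Function.comp_def] using
        (measurable_pi_apply (X := fun j => BidderType n j) j).comp
          (measurable_snd (α := BidderType n i) (β := Profile n))
  refine ⟨hm, ?_⟩
  symm
  refine Measure.pi_eq fun s hs => ?_
  rw [Measure.map_apply hm (MeasurableSet.univ_pi hs)]
  have e : (fun z : BidderType n i × Profile n => Function.update z.2 i z.1) ⁻¹' univ.pi s =
      s i ×ˢ univ.pi (Function.update s i univ) := by
    ext z
    simp only [mem_preimage, mem_univ_pi, mem_prod]
    constructor
    · intro h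
      refine ⟨by simpa using h i, fun j => ?_⟩
      by_cases hj : j = i
      · subst hj; simp
      · simpa [hj] using h j
    · rintro ⟨h1, h2⟩ j
      by_cases hj : j = i
      · subst hj; simpa using h1
      · simpa [hj] using h2 j
  have hpi : M.typeLaw (univ.pi (Function.update s i univ)) =
      ∏ j, ((M.valueLaw j).prod (M.extLaw j)) (Function.update s i univ j) := Measure.pi_pi _ _
  rw [e, Measure.prod_prod, hpi, ← Finset.mul_prod_erase _ _ (Finset.mem_univ i),
    ← Finset.mul_prod_erase _ (fun j => ((M.valueLaw j).prod (M.extLaw j)) (s j))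
      (Finset.mem_univ i)]
  simp only [Function.update_self, measure_univ, one_mul]
  congr 1
  refine Finset.prod_congr rfl fun j hj => ?_
  rw [Function.update_of_ne (Finset.ne_of_mem_erase hj)]

theorem integrable_integral_update {f : Profile n → ℝ} (hf : Integrable f M.typeLaw) :
    Integrable (fun s => ∫ t, f (Function.update t i s) ∂M.typeLaw)
      ((M.valueLaw i).prod (M.extLaw i)) :=
  ((M.measurePreserving_update i).integrable_comp_of_integrable hf).integral_prod_left

/-- The types of buyer `i` can be integrated out last. -/
theorem integral_integral_update {f : Profile n → ℝ} (hf : Integrable f M.typeLaw) :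
    ∫ s, ∫ t, f (Function.update t i s) ∂M.typeLaw ∂(M.valueLaw i).prod (M.extLaw i) =
      ∫ t, f t ∂M.typeLaw := by
  have h := M.measurePreserving_update i
  rw [← integral_prod (fun z : BidderType n i × Profile n => f (Function.update z.2 i z.1))
    (h.integrable_comp_of_integrable hf)]
  conv_rhs => rw [← h.map_eq]
  exact (integral_map h.measurable.aemeasurable
    (by rw [h.map_eq]; exact hf.aestronglyMeasurable)).symm

theorem ae_mem_typeSpace : ∀ᵐ s ∂(M.valueLaw i).prod (M.extLaw i), s ∈ M.typeSpace i := by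
  filter_upwards [Measure.quasiMeasurePreserving_fst.ae (M.ae_mem_Icc_valueLaw i),
    Measure.quasiMeasurePreserving_snd.ae (M.extLaw_range i)] with s h1 h2
  exact ⟨h1, h2⟩

theorem exists_ext_mem : ∃ η : {j : Fin n // j ≠ i} → ℝ,
    ∀ j : {j : Fin n // j ≠ i}, η j ∈ Icc (M.etalo j i) (M.etahi j i) :=
  (M.extLaw_range i).exists

theorem integrable_externality (j : {j : Fin n // j ≠ i}) :
    Integrable (fun t => externality t i j) M.typeLaw :=
  (M.measurePreserving_ext j).integrable_comp_of_integrable (M.integrable_extLaw j ⟨i, j.2.symm⟩)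

theorem integral_externality (j : {j : Fin n // j ≠ i}) :
    ∫ t, externality t i j ∂M.typeLaw = M.meanExt i j := by
  rw [meanExt, ← (M.measurePreserving_ext j).map_eq, integral_map
    (M.measurePreserving_ext j).measurable.aemeasurable
    (measurable_pi_apply _).aestronglyMeasurable]
  rfl

theorem ae_externality_nonneg (j : {j : Fin n // j ≠ i}) :
    ∀ᵐ t ∂M.typeLaw, 0 ≤ externality t i j :=
  (M.measurePreserving_ext j).quasiMeasurePreserving.ae (M.ae_extLaw_nonneg j ⟨i, j.2.symm⟩)

theorem integrable_externality_mul (j : {j : Fin n // j ≠ i}) {x : Profile n → ℝ}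
    (hx : Measurable x) (hx1 : ∀ t, x t ∈ Icc (0 : ℝ) 1) :
    Integrable (fun t => externality t i j * x t) M.typeLaw :=
  (M.integrable_externality i j).mul_bdd (c := 1) hx.aestronglyMeasurable
    (Filter.Eventually.of_forall fun t => by
      rw [Real.norm_eq_abs, abs_of_nonneg (hx1 t).1]; exact (hx1 t).2)

/-- Monotone functions on the range of values are integrable. -/
theorem integrable_of_monotoneOn {q : ℝ → ℝ} (hq : MonotoneOn q (Icc (M.vlo i) (M.vhi i))) :
    Integrable q (M.valueLaw i) := by
  have h := aemeasurable_restrict_of_monotoneOn (μ := M.valueLaw i) measurableSet_Icc hq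
  rw [Measure.restrict_eq_self_of_ae_mem (M.ae_mem_Icc_valueLaw i)] at h
  exact Integrable.of_mem_Icc (q (M.vlo i)) (q (M.vhi i)) h
    ((M.ae_mem_Icc_valueLaw i).mono fun v hv =>
      ⟨hq (M.vlo_mem i) hv hv.1, hq hv (M.vhi_mem i) hv.2⟩)

/-- The revenue extracted from one buyer by a monotone interim allocation is at most that of a
threshold. -/
theorem exists_threshold_ge (hM : M.Regular) : ∃ σ ∈ Icc (M.vlo i) (M.vhi i),
    ∀ q u : ℝ → ℝ, MonotoneOn q (Icc (M.vlo i) (M.vhi i)) →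
      (∀ v ∈ Icc (M.vlo i) (M.vhi i), q v ∈ Icc (0 : ℝ) 1) →
      (∀ v ∈ Icc (M.vlo i) (M.vhi i), u v = u (M.vlo i) + ∫ s in M.vlo i..v, q s) →
      M.causedExt i + ∫ v, ((v - M.causedExt i) * q v - (u v - u (M.vlo i))) ∂M.valueLaw i ≤
        M.buyerRev i σ := by
  have hanti := hM.antitoneOn_marginalRev i
  set a := M.vlo i with ha
  set b := M.vhi i with hb
  set ψ := M.marginalRev i with hψ
  have hab : a ≤ b := (M.vlo_lt_vhi i).le
  -- The supremum is where the marginal revenue changes sign; inserting `a` covers the case in which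
  -- it is negative throughout.
  let S : Set ℝ := insert a {x | x ∈ Icc a b ∧ 0 ≤ ψ x}
  have hSne : S.Nonempty := ⟨a, mem_insert _ _⟩
  have hSb : ∀ x ∈ S, x ≤ b := by
    rintro x (rfl | hx)
    exacts [hab, hx.1.2]
  have hSbdd : BddAbove S := ⟨b, hSb⟩
  have hσ : sSup S ∈ Icc a b := ⟨le_csSup hSbdd (mem_insert _ _), csSup_le hSne hSb⟩
  refine ⟨sSup S, hσ, fun q u hq hq01 hu => ?_⟩
  have hpos : ∀ x ∈ Ioo a (sSup S), 0 ≤ ψ x := fun x hx => by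
    obtain ⟨y, hy, hxy⟩ := exists_lt_of_lt_csSup hSne hx.2
    rcases hy with rfl | hy
    · exact absurd hxy hx.1.le.not_gt
    · exact hy.2.trans (hanti ⟨hx.1.le, hxy.le.trans hy.1.2⟩ hy.1 hxy.le)
  have hneg : ∀ x ∈ Ioo (sSup S) b, ψ x ≤ 0 := fun x hx => by
    by_contra h
    exact hx.1.not_ge (le_csSup hSbdd (mem_insert_of_mem _
      ⟨⟨hσ.1.trans hx.1.le, hx.2.le⟩, (not_le.1 h).le⟩))
  have hqi : ∀ x ∈ Icc a b, ∀ y ∈ Icc a b, IntervalIntegrable q volume x y := fun x hx y hy =>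
    (hq.mono (uIcc_subset_Icc hx hy)).intervalIntegrable
  have hqb : ∀ᵐ v ∂volume.restrict (Icc a b), ‖q v‖ ≤ 1 := by
    filter_upwards [ae_restrict_mem measurableSet_Icc] with v hv
    rw [Real.norm_eq_abs, abs_of_nonneg (hq01 v hv).1]; exact (hq01 v hv).2
  have hψi : IntegrableOn ψ (Icc a b) := hanti.integrableOn_isCompact isCompact_Icc
  have hqm : AEStronglyMeasurable q (volume.restrict (Icc a b)) :=
    (aemeasurable_restrict_of_monotoneOn measurableSet_Icc hq).aestronglyMeasurable
  have hψq : IntegrableOn (fun v => ψ v * q v) (Icc a b) := hψi.mul_bdd hqm hqb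
  have hsub : ∀ {f : ℝ → ℝ}, IntegrableOn f (Icc a b) → ∀ x ∈ Icc a b, ∀ y ∈ Icc a b,
      IntervalIntegrable f volume x y := fun hf x hx y hy =>
    (hf.mono_set (uIcc_subset_Icc hx hy)).intervalIntegrable
  have ham := M.vlo_mem i
  have hbm := M.vhi_mem i
  -- `F - 1` vanishes at `b` and `u - u a` at `a`, so there is no boundary term: the information
  -- rent becomes an integral of `(1 - F) * q`.
  have hparts := integral_mul_add_mul_of_primitive (F := fun v => M.valueCDF i v - 1)
    (f := M.density i) (Q := fun v => u v - u a) (q := q) hab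
    (M.intervalIntegrable_density i ham hbm) (hqi a ham b hbm)
    (fun t ht => by
      rw [M.valueCDF_eq_add_integral i ham ht]; ring)
    (fun t ht => by rw [hu t ht]; ring)
  rw [M.valueCDF_vhi] at hparts
  simp only [sub_self, zero_mul, mul_zero] at hparts
  have hd := M.intervalIntegrable_density i ham hbm
  have huc : ContinuousOn u (uIcc a b) := by
    have h := intervalIntegral.continuousOn_primitive_interval (μ := volume) (f := q) (a := a)
      (b := b) (by rw [uIcc_of_le hab]; exact (intervalIntegrable_iff_integrableOn_Icc_of_le hab).1 (hqi a ham b hbm))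
    refine (h.const_add (u a)).congr fun x hx => ?_
    rw [uIcc_of_le hab] at hx
    exact hu x hx
  have hI1 : IntervalIntegrable (fun v => M.density i v * (u v - u a)) volume a b :=
    hd.mul_continuousOn (huc.sub continuousOn_const)
  have hI2 : IntervalIntegrable (fun v => (M.valueCDF i v - 1) * q v) volume a b := by
    refine hsub (f := fun v => (M.valueCDF i v - 1) * q v) ?_ a ham b hbm
    refine Integrable.mul_bdd (c := 1) ?_ hqm hqb
    exact (((M.monotone_valueCDF i).monotoneOn _).integrableOn_isCompact isCompact_Icc).sub
      (integrableOn_const (by simp))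
  have hmain : ∫ v, ((v - M.causedExt i) * q v - (u v - u a)) ∂M.valueLaw i =
      -∫ v in a..b, ψ v * q v := by
    rw [M.integral_valueLaw, ← intervalIntegral.integral_neg, ← sub_eq_zero,
      ← neg_eq_zero, ← hparts, neg_sub, ← intervalIntegral.integral_sub]
    · congr 1
      ext v
      rw [hψ, marginalRev]; ring
    · exact (hsub hψq a ham b hbm).neg
    · have : (fun v => M.density i v * ((v - M.causedExt i) * q v - (u v - u a))) =
          fun v => (-(ψ v * q v) - (M.density i v * (u v - u a) + (M.valueCDF i v - 1) * q v)) := by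
        ext v
        rw [hψ, marginalRev]; ring
      rw [this]
      exact (hsub hψq a ham b hbm).neg.sub (hI1.add hI2)
  have hsplit := intervalIntegral.integral_add_adjacent_intervals
    (hsub hψq a ham _ hσ) (hsub hψq _ hσ b hbm)
  have hleft : 0 ≤ ∫ v in a..sSup S, ψ v * q v := by
    have := intervalIntegral.integral_mono_on_of_le_Ioo hσ.1 (intervalIntegrable_const (c := (0 : ℝ)))
      (hsub hψq a ham _ hσ) fun v hv =>
        mul_nonneg (hpos v hv) (hq01 v ⟨hv.1.le, hv.2.le.trans hσ.2⟩).1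
    simpa using this
  -- Left of the threshold the best choice is `q = 0`, right of it `q = 1`: the extremal allocation
  -- is the threshold itself.
  have hright : ∫ v in sSup S..b, ψ v ≤ ∫ v in sSup S..b, ψ v * q v :=
    intervalIntegral.integral_mono_on_of_le_Ioo hσ.2 (hsub hψi _ hσ b hbm)
      (hsub hψq _ hσ b hbm) fun v hv => by
        have h1 := hneg v hv
        have h2 := (hq01 v ⟨hσ.1.trans hv.1.le, hv.2.le⟩).2
        nlinarith
  have hR := M.buyerRev_sub_buyerRev i hσ hbm
  -- At price `b` a sale has probability zero, so only the compensation is earned; this fixes the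
  -- constant of integration.
  have hRb : M.buyerRev i b = M.causedExt i := by
    rw [buyerRev, M.valueCDF_vhi]; ring
  rw [hRb] at hR
  rw [hmain]
  linarith

end Market

/-! ### Upper bound for incentive compatible mechanisms -/

namespace Mechanism

variable {n : ℕ} (m : Mechanism n) (M : Market n) (i : Fin n)

/-- The interim allocation of buyer `i` when her bid is the type `s`. -/
noncomputable def interimAlloc (s : BidderType n i) : ℝ :=
  ∫ t, m.alloc (truthful (Function.update t i s)) i ∂M.typeLaw

/-- The interim payment of buyer `i` when her bid is the type `s`. -/
noncomputable def interimPay (s : BidderType n i) : ℝ :=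
  ∫ t, m.pay (truthful (Function.update t i s)) i ∂M.typeLaw

/-- The expected externality suffered by buyer `i` when her bid is the type `s`. -/
noncomputable def interimExt (s : BidderType n i) : ℝ :=
  ∫ t, ∑ j : {j : Fin n // j ≠ i},
    externality t i j * m.alloc (truthful (Function.update t i s)) j ∂M.typeLaw

variable {m M}

theorem measurable_update_const (s : BidderType n i) :
    Measurable fun t : Profile n => Function.update t i s :=
  measurable_update_left

theorem Feasible.integrable_alloc (h : m.Feasible M) (s : BidderType n i) (j : Fin n) :
    Integrable (fun t => m.alloc (truthful (Function.update t i s)) j) M.typeLaw :=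
  Integrable.of_mem_Icc 0 1 ((h.alloc_measurable j).comp (measurable_update_const i s)).aemeasurable
    (Filter.Eventually.of_forall fun _ => h.alloc_mem _ _)

theorem Feasible.integrable_ext (h : m.Feasible M) (s : BidderType n i)
    (j : {j : Fin n // j ≠ i}) :
    Integrable (fun t => externality t i j * m.alloc (truthful (Function.update t i s)) j)
      M.typeLaw :=
  M.integrable_externality_mul i j ((h.alloc_measurable j).comp (measurable_update_const i s))
    fun _ => h.alloc_mem _ _

theorem Feasible.interimUtility_some (h : m.Feasible M) {s : BidderType n i}
    (hs : s ∈ M.typeSpace i) (t : BidderType n i) :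
    m.interimUtility M i (some s) t =
      t.1 * m.interimAlloc M i s - m.interimExt M i s - m.interimPay M i s := by
  have hpay : Integrable (fun t => m.pay (truthful (Function.update t i s)) i) M.typeLaw := by
    simp_rw [truthful_update]; exact h.pay_interim_integrable i s hs
  have h1 := (h.integrable_alloc i s i).const_mul t.1
  have h2 := integrable_finsetSum Finset.univ fun j _ => h.integrable_ext i s j
  have h12 : Integrable (fun t' : Profile n => t.1 * m.alloc (truthful (Function.update t' i s)) i -
      ∑ j : {j : Fin n // j ≠ i},
        externality t' i j * m.alloc (truthful (Function.update t' i s)) j) M.typeLaw := h1.sub h2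
  unfold interimUtility utility interimAlloc interimExt interimPay
  simp_rw [externality_update, ← truthful_update, Function.update_self]
  rw [integral_sub h12 hpay, integral_sub h1 h2, integral_const_mul]

/-- The worst punishment for staying out is to serve everybody else with certainty. -/
theorem Feasible.neg_sum_meanExt_le (h : m.Feasible M) (t : BidderType n i) :
    -∑ j : {j : Fin n // j ≠ i}, M.meanExt i j ≤ m.interimUtility M i none t := by
  unfold interimUtility utility
  have h0 : ∀ t' : Profile n, m.alloc (Function.update (truthful t') i none) i = 0 ∧
      m.pay (Function.update (truthful t') i none) i = 0 := fun t' =>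
    h.outside _ i (by simp)
  simp_rw [externality_update, (h0 _).1, (h0 _).2]
  simp only [mul_zero, zero_sub, sub_zero]
  have hint : ∀ j : {j : Fin n // j ≠ i}, Integrable (fun t' : Profile n =>
      externality t' i j * m.alloc (Function.update (truthful t') i none) j) M.typeLaw := fun j =>
    M.integrable_externality_mul i j (h.alloc_out_measurable i j) fun _ => h.alloc_mem _ _
  rw [integral_neg, neg_le_neg_iff, integral_finsetSum _ fun j _ => hint j]
  refine Finset.sum_le_sum fun j _ => ?_
  rw [← M.integral_externality]
  refine integral_mono_ae (hint j) (M.integrable_externality i j) ?_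
  filter_upwards [M.ae_externality_nonneg i j] with t' ht'
  exact mul_le_of_le_one_right ht' (h.alloc_mem _ _).2

theorem Feasible.interimAlloc_mem (h : m.Feasible M) (s : BidderType n i) :
    m.interimAlloc M i s ∈ Icc (0 : ℝ) 1 := by
  refine ⟨integral_nonneg fun t => (h.alloc_mem _ _).1, ?_⟩
  have := integral_mono (h.integrable_alloc i s i) (integrable_const (1 : ℝ))
    fun t => (h.alloc_mem _ _).2
  simpa [interimAlloc] using this

/-- The envelope representation of the interim utilities under incentive compatibility: they
depend only on the value, and the interim allocation is almost surely a function of the value. -/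
theorem exists_envelope (h : m.Feasible M) (hIC : m.BNIC M) (hIR : m.InterimIR M) :
    ∃ q u : ℝ → ℝ, MonotoneOn q (Icc (M.vlo i) (M.vhi i)) ∧
      MonotoneOn u (Icc (M.vlo i) (M.vhi i)) ∧
      (∀ v ∈ Icc (M.vlo i) (M.vhi i), q v ∈ Icc (0 : ℝ) 1) ∧
      (∀ v ∈ Icc (M.vlo i) (M.vhi i), u v = u (M.vlo i) + ∫ s in M.vlo i..v, q s) ∧
      (-∑ j : {j : Fin n // j ≠ i}, M.meanExt i j ≤ u (M.vlo i)) ∧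
      (∀ s ∈ M.typeSpace i, s.1 * m.interimAlloc M i s - m.interimExt M i s -
        m.interimPay M i s = u s.1) ∧
      ∀ᵐ s ∂(M.valueLaw i).prod (M.extLaw i), m.interimAlloc M i s = q s.1 := by
  -- One admissible externality vector serves as reference: `q` and `u` are read off along the types
  -- `(v, η)`.
  obtain ⟨η, hη⟩ := M.exists_ext_mem i
  have hmem : ∀ v ∈ Icc (M.vlo i) (M.vhi i), ((v, η) : BidderType n i) ∈ M.typeSpace i :=
    fun v hv => ⟨hv, hη⟩
  let q : ℝ → ℝ := fun v => m.interimAlloc M i (v, η)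
  let u : ℝ → ℝ := fun v => v * q v - m.interimExt M i (v, η) - m.interimPay M i (v, η)
  have hIC' : ∀ s ∈ M.typeSpace i, ∀ t ∈ M.typeSpace i,
      t.1 * m.interimAlloc M i s - m.interimExt M i s - m.interimPay M i s ≤
      t.1 * m.interimAlloc M i t - m.interimExt M i t - m.interimPay M i t := fun s hs t ht => by
    rw [← h.interimUtility_some i hs, ← h.interimUtility_some i ht]
    exact hIC i t ht s hs
  -- Two types with equal values obtain the same utility from every bid, so neither truthful utility
  -- can exceed the other.
  have hval : ∀ s ∈ M.typeSpace i, s.1 * m.interimAlloc M i s - m.interimExt M i s -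
      m.interimPay M i s = u s.1 := fun s hs =>
    le_antisymm (hIC' s hs (s.1, η) (hmem _ hs.1)) (hIC' (s.1, η) (hmem _ hs.1) s hs)
  have hsub : ∀ s ∈ M.typeSpace i, ∀ y ∈ Icc (M.vlo i) (M.vhi i),
      m.interimAlloc M i s * (y - s.1) ≤ u y - u s.1 := fun s hs y hy => by
    have := hIC' s hs (y, η) (hmem y hy)
    rw [hval _ (hmem y hy)] at this
    rw [← hval s hs]
    simp only at this
    linarith
  have hsubq : ∀ x ∈ Icc (M.vlo i) (M.vhi i), ∀ y ∈ Icc (M.vlo i) (M.vhi i),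
      q x * (y - x) ≤ u y - u x := fun x hx => hsub (x, η) (hmem x hx)
  have hq01 : ∀ v, q v ∈ Icc (0 : ℝ) 1 := fun v => h.interimAlloc_mem i _
  have hbetween : ∀ s ∈ M.typeSpace i, ∀ y ∈ Icc (M.vlo i) (M.vhi i),
      (m.interimAlloc M i s - q y) * (y - s.1) ≤ 0 := fun s hs y hy => by
    have h1 := hsub s hs y hy
    have h2 := hsubq y hy s.1 hs.1
    linarith
  have hqm : MonotoneOn q (Icc (M.vlo i) (M.vhi i)) := fun x hx y hy hxy => by
    rcases hxy.eq_or_lt with rfl | hlt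
    · exact le_rfl
    · have := hbetween (x, η) (hmem x hx) y hy
      simp only at this
      have h2 : q x - q y ≤ 0 := by
        by_contra hc
        exact this.not_gt (mul_pos (not_le.1 hc) (sub_pos.2 hlt))
      linarith
  refine ⟨q, u, hqm, ?_, fun v _ => hq01 v, ?_, ?_, hval, ?_⟩
  · intro x hx y hy hxy
    have := hsubq x hx y hy
    have := mul_nonneg (hq01 x).1 (sub_nonneg.2 hxy)
    linarith
  · intro v hv
    rw [integral_subgradient hqm hsubq (M.vlo_mem i) hv]; ring
  · have h1 := hmem _ (M.vlo_mem i)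
    have h2 := hIR i _ h1
    rw [h.interimUtility_some i h1] at h2
    exact (h.neg_sum_meanExt_le i _).trans h2
  · have hcount := hqm.countable_not_continuousWithinAt
    -- The exceptional values are countably many, hence null for a law without atoms. Elsewhere
    -- `hbetween` traps the allocation of every type with value `v` between the one-sided limits of
    -- `q`.
    have hae : ∀ᵐ v ∂M.valueLaw i, v ∈ Ioo (M.vlo i) (M.vhi i) ∧
        ContinuousWithinAt q (Icc (M.vlo i) (M.vhi i)) v := by
      have hc2 := (hcount.union (countable_singleton (M.vlo i))).union
        (countable_singleton (M.vhi i))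
      filter_upwards [M.ae_mem_Icc_valueLaw i, hc2.ae_notMem (M.valueLaw i)] with v hv hv'
      simp only [mem_union, mem_ofPred_eq, mem_singleton_iff, not_or, not_and, not_not] at hv'
      exact ⟨⟨lt_of_le_of_ne hv.1 (Ne.symm hv'.1.2), lt_of_le_of_ne hv.2 hv'.2⟩, hv'.1.1 hv⟩
    filter_upwards [M.ae_mem_typeSpace i, Measure.quasiMeasurePreserving_fst.ae hae] with s hs hs'
    refine eq_of_continuousWithinAt_of_between hs'.1 hs'.2 (fun y hy hlt => ?_) fun y hy hlt => ?_
    · have := hbetween s hs y hy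
      by_contra hc
      nlinarith [mul_pos (sub_pos.2 (not_le.1 hc)) (sub_pos.2 hlt)]
    · have := hbetween s hs y hy
      by_contra hc
      nlinarith [mul_pos (sub_pos.2 (not_le.1 hc)) (sub_pos.2 hlt)]

/-- The expected externality of `j` on `i` for an interim allocation of `j` that is a function of
her value. -/
theorem Feasible.integral_externality_mul_alloc (h : m.Feasible M) (j : {j : Fin n // j ≠ i})
    {q : ℝ → ℝ}
    (hq : ∀ᵐ s ∂(M.valueLaw j).prod (M.extLaw j), m.interimAlloc M j s = q s.1) :
    ∫ t, externality t i j * m.alloc (truthful t) j ∂M.typeLaw =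
      M.meanExt i j * ∫ v, q v ∂M.valueLaw j := by
  have hi : Integrable (fun t => externality t i j * m.alloc (truthful t) j) M.typeLaw :=
    M.integrable_externality_mul i j (h.alloc_measurable j) fun _ => h.alloc_mem _ _
  rw [← M.integral_integral_update j hi]
  have e : ∀ (s : BidderType n j) (t : Profile n),
      externality (Function.update t j s) i j = s.2 ⟨i, j.2.symm⟩ := fun s t => by
    simp [externality]
  -- With the type of `j` fixed, the externality she causes is constant and only her interim
  -- allocation remains; it depends on her value alone, which is independent of that externality.
  simp_rw [e, integral_const_mul]
  have : ∫ s, s.2 ⟨i, j.2.symm⟩ * ∫ t, m.alloc (truthful (Function.update t j s)) j ∂M.typeLaw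
      ∂(M.valueLaw j).prod (M.extLaw j) =
      ∫ s, q s.1 * s.2 ⟨i, j.2.symm⟩ ∂(M.valueLaw j).prod (M.extLaw j) := by
    refine integral_congr_ae ?_
    filter_upwards [hq] with s hs
    rw [← hs, mul_comm]; rfl
  have hprod : ∫ s, q s.1 * s.2 ⟨i, j.2.symm⟩ ∂(M.valueLaw j).prod (M.extLaw j) =
      (∫ v, q v ∂M.valueLaw j) * ∫ η, η ⟨i, j.2.symm⟩ ∂M.extLaw j :=
    integral_prod_mul q fun η : {k : Fin n // k ≠ j} → ℝ => η ⟨i, j.2.symm⟩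
  rw [this, hprod, mul_comm, Market.meanExt]

/-- Incentive compatible and individually rational mechanisms do not earn more than posted
prices. -/
theorem exists_thresholds_rev_le (hM : M.Regular) (h : m.Feasible M) (hIC : m.BNIC M)
    (hIR : m.InterimIR M) : ∃ σ : Fin n → ℝ, (∀ i, σ i ∈ Icc (M.vlo i) (M.vhi i)) ∧
      m.rev M ≤ ∑ i, M.buyerRev i (σ i) := by
  choose q u hqm hum hq01 hu hlo hval hae using fun i => exists_envelope i h hIC hIR
  choose σ hσ hmax using fun i => M.exists_threshold_ge i hM
  refine ⟨σ, hσ, ?_⟩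
  have hqi : ∀ i, Integrable (q i) (M.valueLaw i) := fun i => M.integrable_of_monotoneOn i (hqm i)
  have hui : ∀ i, Integrable (u i) (M.valueLaw i) := fun i => M.integrable_of_monotoneOn i (hum i)
  have hvqi : ∀ i, Integrable (fun v => v * q i v) (M.valueLaw i) := fun i =>
    M.integrable_of_monotoneOn i fun x hx y hy hxy =>
      mul_le_mul hxy (hqm i hx hy hxy) (hq01 i x hx).1 ((M.vlo_nonneg i).trans hy.1)
  have hpay : ∀ i, ∫ t, m.pay (truthful t) i ∂M.typeLaw =
      ∫ v, (v * q i v - u i v) ∂M.valueLaw i -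
        ∑ j : {j : Fin n // j ≠ i}, M.meanExt i j * ∫ v, q j v ∂M.valueLaw j := fun i => by
    have hext : Integrable (fun t => ∑ j : {j : Fin n // j ≠ i},
        externality t i j * m.alloc (truthful t) j) M.typeLaw :=
      integrable_finsetSum _ fun j _ =>
        M.integrable_externality_mul i j (h.alloc_measurable j) fun _ => h.alloc_mem _ _
    have hext' := M.integrable_integral_update i hext
    have e1 : ∫ t, m.pay (truthful t) i ∂M.typeLaw =
        ∫ s, ((s.1 * q i s.1 - u i s.1) - ∫ t, ∑ j : {j : Fin n // j ≠ i},
          externality (Function.update t i s) i j * m.alloc (truthful (Function.update t i s)) j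
            ∂M.typeLaw) ∂(M.valueLaw i).prod (M.extLaw i) := by
      rw [← M.integral_integral_update i (h.pay_integrable i)]
      refine integral_congr_ae ?_
      filter_upwards [M.ae_mem_typeSpace i, hae i] with s hs hs'
      have := hval i s hs
      rw [hs'] at this
      simp_rw [externality_update]
      change m.interimPay M i s = s.1 * q i s.1 - u i s.1 - m.interimExt M i s
      linarith
    have hdiff : Integrable (fun v => v * q i v - u i v) (M.valueLaw i) := (hvqi i).sub (hui i)
    rw [e1, integral_sub (hdiff.comp_fst _) hext', M.integral_integral_update i hext,
      integral_finsetSum _ fun j _ => M.integrable_externality_mul i j (h.alloc_measurable j)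
        fun _ => h.alloc_mem _ _,
      integral_fun_fst (fun v => v * q i v - u i v)]
    simp only [probReal_univ, one_smul]
    congr 1
    exact Finset.sum_congr rfl fun j _ => h.integral_externality_mul_alloc i j (hae j)
  unfold rev
  rw [integral_finsetSum _ fun i _ => h.pay_integrable i]
  simp_rw [hpay]
  rw [Finset.sum_sub_distrib, M.sum_sum_meanExt_mul fun j => ∫ v, q j v ∂M.valueLaw j,
    ← Finset.sum_sub_distrib]
  -- The outside options are bounded by externalities suffered; only after summing over buyers do
  -- these become the externalities caused that `hbuyer` needs.
  have hlo_sum : -∑ i, M.causedExt i ≤ ∑ i, u i (M.vlo i) := by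
    have h1 := M.sum_sum_meanExt_mul fun _ => 1
    simp only [mul_one] at h1
    rw [← h1, ← Finset.sum_neg_distrib]
    exact Finset.sum_le_sum fun i _ => hlo i
  have hbuyer : ∀ i, ∫ v, (v * q i v - u i v) ∂M.valueLaw i -
      M.causedExt i * ∫ v, q i v ∂M.valueLaw i ≤
      M.buyerRev i (σ i) - M.causedExt i - u i (M.vlo i) := fun i => by
    have h1 := hmax i (q i) (u i) (hqm i) (hq01 i) (hu i)
    have e : (fun v => (v - M.causedExt i) * q i v - (u i v - u i (M.vlo i))) =
        fun v => (v * q i v - u i v) - M.causedExt i * q i v + u i (M.vlo i) := by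
      ext v; ring
    have hdiff : Integrable (fun v => v * q i v - u i v) (M.valueLaw i) := (hvqi i).sub (hui i)
    have hdiff' : Integrable (fun v => v * q i v - u i v - M.causedExt i * q i v)
      (M.valueLaw i) := hdiff.sub ((hqi i).const_mul _)
    rw [e, integral_add hdiff' (integrable_const _),
      integral_sub hdiff ((hqi i).const_mul _), integral_const_mul] at h1
    simp only [integral_const, probReal_univ, one_smul] at h1
    linarith
  refine (Finset.sum_le_sum fun i _ => hbuyer i).trans ?_
  rw [Finset.sum_sub_distrib, Finset.sum_sub_distrib]
  linarith

end Mechanism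

/-! ### The algorithm as independent one-buyer recursions in time -/

section Learning

variable {n : ℕ} (M : Market n) {δ γ : ℝ} {τ₁ : Fin n → ℝ} {Ω : Type*} [MeasurableSpace Ω]
  {P : Measure Ω} {t : ℕ → Ω → Profile n} {u : ℕ → Ω → Fin n → ℝ}

/-- The thresholds of buyer `i` are driven only by her own values and noise, so the recursion
decouples across buyers. -/
theorem measurePreserving_value_noise (i : Fin n) :
    MeasurePreserving (fun z : Profile n × (Fin n → ℝ) => ((z.1 i).1, z.2 i))
      (M.typeLaw.prod (noiseLaw n)) ((M.valueLaw i).prod uniformNoise) :=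
  (M.measurePreserving_value i).prod
    (measurePreserving_eval (fun _ : Fin n => uniformNoise) i)

theorem measurable_thresholds (ht : ∀ k, Measurable (t k)) (hu : ∀ k, Measurable (u k)) (k : ℕ)
    (i : Fin n) :
    Measurable fun ω => thresholds M δ γ τ₁ (fun k => t k ω) (fun k => u k ω) k i := by
  refine measurable_of_recursion (W := fun k ω => ((t k ω i).1, u k ω i)) (x₀ := τ₁ i)
    (T := fun k ω => thresholds M δ γ τ₁ (fun k => t k ω) (fun k => u k ω) k i)
    (M.measurable_stepThreshold i δ γ) (fun k => ?_) (fun _ => rfl) (fun _ _ => rfl) k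
  exact (measurable_fst.comp ((measurable_pi_apply i).comp (ht k))).prodMk
    ((measurable_pi_apply i).comp (hu k))

variable [IsProbabilityMeasure P]

theorem integrable_buyerRev_avgThresholds {w B : ℝ} (hδ : 0 < δ) (hδw : 2 * δ ≤ w)
    {i : Fin n} (hw : w ≤ M.vhi i - M.vlo i) (hB : M.vhi i ≤ B) (hc : M.causedExt i ≤ B)
    (hτ₁ : τ₁ i ∈ Icc (M.vlo i) (M.vhi i))
    (ht : ∀ k, Measurable (t k)) (hu : ∀ k, Measurable (u k)) {K : ℕ} (hK : 1 ≤ K) :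
    Integrable (fun ω =>
      M.buyerRev i (avgThresholds M δ γ τ₁ (fun k => t k ω) (fun k => u k ω) K i)) P :=
  M.integrable_buyerRev i
    ((Finset.measurable_sum _ fun k _ => measurable_thresholds M ht hu k i).div_const _) hB hc
    fun ω => Market.average_mem hK fun k =>
      M.thresholds_mem i (W := fun k ω => ((t k ω i).1, u k ω i)) hδ (hδw.trans hw) hτ₁
        (T := fun k ω => thresholds M δ γ τ₁ (fun k => t k ω) (fun k => u k ω) k i)
        (fun _ => rfl) (fun _ _ => rfl) k ω

/-- The regret of the learning algorithm on one buyer. -/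
theorem buyerRev_sub_integral_avgThresholds_le {w B : ℝ} (hM : M.Regular) (hδ : 0 < δ)
    (hγ : 0 < γ) (hδw : 2 * δ ≤ w) {i : Fin n} (hw : w ≤ M.vhi i - M.vlo i) (hB : M.vhi i ≤ B)
    (hc : M.causedExt i ≤ B) (hτ₁ : τ₁ i ∈ Icc (M.vlo i) (M.vhi i))
    (ht : ∀ k, Measurable (t k)) (hu : ∀ k, Measurable (u k))
    (hind : iIndepFun (fun k ω => (t k ω, u k ω)) P)
    (hlaw : ∀ k, P.map (fun ω => (t k ω, u k ω)) = M.typeLaw.prod (noiseLaw n))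
    {K : ℕ} (hK : 1 ≤ K) {σ : ℝ} (hσ : σ ∈ Icc (M.vlo i) (M.vhi i)) :
    M.buyerRev i σ - ∫ ω,
      M.buyerRev i (avgThresholds M δ γ τ₁ (fun k => t k ω) (fun k => u k ω) K i) ∂P ≤
      2 * δ / w * B + 3 * B ^ 2 / (2 * γ * K) + 3 * γ * B ^ 2 / (2 * δ ^ 2) + B / K := by
  have hmp := measurePreserving_value_noise M i
  have hm : ∀ k, Measurable fun ω => (t k ω, u k ω) := fun k => (ht k).prodMk (hu k)
  refine M.buyerRev_sub_integral_average_le i hM hB hc hδ hγ hδw hw hτ₁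
    (W := fun k ω => ((t k ω i).1, u k ω i))
    (T := fun k ω => thresholds M δ γ τ₁ (fun k => t k ω) (fun k => u k ω) k i)
    (fun k => hmp.measurable.comp (hm k)) (hind.comp _ fun _ => hmp.measurable)
    (fun k => ?_) (fun _ => rfl) (fun _ _ => rfl) hK hσ
  rw [← hmp.map_eq, ← hlaw k, Measure.map_map hmp.measurable (hm k)]
  rfl

end Learning

end DataMarket

/-! ### Choice of parameters and conclusion -/

theorem mainTheorem8 (w B : ℝ) (hw : 0 < w) :
    ∃ C : ℝ, ∀ K : ℕ, 1 ≤ K → ∃ δ γ : ℝ, 0 < δ ∧ 2 * δ < w ∧ 0 < γ ∧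
      ∀ (n : ℕ) (M : DataMarket.Market n), M.Regular →
        (∀ i, w ≤ M.vhi i - M.vlo i) → (∀ i, M.vhi i ≤ B) → (∀ i, M.causedExt i ≤ B) →
      ∀ τ₁ : Fin n → ℝ, (∀ i, τ₁ i ∈ Set.Icc (M.vlo i) (M.vhi i)) →
      ∀ (Ω : Type*) [MeasurableSpace Ω] (P : MeasureTheory.Measure Ω)
        [MeasureTheory.IsProbabilityMeasure P]
        (t : ℕ → Ω → DataMarket.Profile n) (u : ℕ → Ω → Fin n → ℝ),
        (∀ k, Measurable (t k)) → (∀ k, Measurable (u k)) →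
        ProbabilityTheory.iIndepFun (fun k ω => (t k ω, u k ω)) P →
        (∀ k, P.map (fun ω => (t k ω, u k ω)) = M.typeLaw.prod (DataMarket.noiseLaw n)) →
        MeasureTheory.Integrable
          (fun ω => DataMarket.learnedRev M δ γ τ₁ (fun k => t k ω) (fun k => u k ω) K) P ∧
        (∀ τ : Fin n → ℝ, (∀ i, τ i ∈ Set.Icc (M.vlo i) (M.vhi i)) →
          (DataMarket.postedPrice M τ).rev M -
              ∫ ω, DataMarket.learnedRev M δ γ τ₁ (fun k => t k ω) (fun k => u k ω) K ∂P
            ≤ C * (n / (K : ℝ) ^ (1 / 4 : ℝ))) ∧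
        (∀ m : DataMarket.Mechanism n, m.Feasible M → m.BNIC M → m.InterimIR M →
          m.rev M -
              ∫ ω, DataMarket.learnedRev M δ γ τ₁ (fun k => t k ω) (fun k => u k ω) K ∂P
            ≤ C * (n / (K : ℝ) ^ (1 / 4 : ℝ))) := by
  -- The four summands are the coefficients of K^(-1/4) in the four terms of the one-buyer regret
  -- bound (`e1` to `e4`).
  refine ⟨B / 2 + 3 * B ^ 2 / 2 + 24 * B ^ 2 / w ^ 2 + B, fun K hK => ?_⟩
  have hK1 : (1 : ℝ) ≤ K := by exact_mod_cast hK
  have hK0 : (0 : ℝ) < K := by linarith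
  obtain ⟨κ, hκ⟩ : ∃ κ : ℝ, κ = ((K : ℝ) ^ (1 / 4 : ℝ))⁻¹ := ⟨_, rfl⟩
  have hκ0 : 0 < κ := by rw [hκ]; positivity
  have hκ1 : κ ≤ 1 := by
    rw [hκ]; exact inv_le_one_of_one_le₀ (Real.one_le_rpow hK1 (by norm_num))
  have hκ4 : κ ^ 4 = (K : ℝ)⁻¹ := by
    rw [hκ, inv_pow, ← Real.rpow_natCast, ← Real.rpow_mul hK0.le]
    norm_num
  have hδw : 2 * (w * κ / 4) < w := by nlinarith
  -- With `K = κ⁻¹ ^ 4`, these make δ/w, 1/(γK) and γ/δ² all proportional to `κ`.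
  refine ⟨w * κ / 4, κ ^ 3, by positivity, hδw, by positivity, ?_⟩
  intro n M hM hMw hMB hMc τ₁ hτ₁ Ω _ P _ t u ht hu hind hlaw
  have hδ : 0 < w * κ / 4 := by positivity
  have hγ : 0 < κ ^ 3 := by positivity
  have hint := fun i => DataMarket.integrable_buyerRev_avgThresholds M (P := P) (γ := κ ^ 3) hδ
    hδw.le (hMw i) (hMB i) (hMc i) (hτ₁ i) ht hu hK
  have hrev : ∀ ω, DataMarket.learnedRev M (w * κ / 4) (κ ^ 3) τ₁ (fun k => t k ω)
      (fun k => u k ω) K = ∑ i, M.buyerRev i (DataMarket.avgThresholds M (w * κ / 4) (κ ^ 3) τ₁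
        (fun k => t k ω) (fun k => u k ω) K i) := fun ω => DataMarket.rev_postedPrice M _
  simp_rw [hrev]
  have hregret : ∀ σ : Fin n → ℝ, (∀ i, σ i ∈ Set.Icc (M.vlo i) (M.vhi i)) →
      ∑ i, M.buyerRev i (σ i) - ∫ ω, ∑ i, M.buyerRev i (DataMarket.avgThresholds M (w * κ / 4)
        (κ ^ 3) τ₁ (fun k => t k ω) (fun k => u k ω) K i) ∂P ≤
      (B / 2 + 3 * B ^ 2 / 2 + 24 * B ^ 2 / w ^ 2 + B) * (n / (K : ℝ) ^ (1 / 4 : ℝ)) := by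
    intro σ hσ
    rw [integral_finsetSum _ fun i _ => hint i, ← Finset.sum_sub_distrib,
      div_eq_mul_inv (n : ℝ), ← hκ]
    have hone : ∀ i ∈ Finset.univ, M.buyerRev i (σ i) - ∫ ω, M.buyerRev i
        (DataMarket.avgThresholds M (w * κ / 4) (κ ^ 3) τ₁ (fun k => t k ω) (fun k => u k ω) K i) ∂P
        ≤ (B / 2 + 3 * B ^ 2 / 2 + 24 * B ^ 2 / w ^ 2 + B) * κ := by
      intro i _
      have hB0 : 0 ≤ B := (M.causedExt_nonneg i).trans (hMc i)
      refine (DataMarket.buyerRev_sub_integral_avgThresholds_le M hM hδ hγ hδw.le (hMw i) (hMB i)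
        (hMc i) (hτ₁ i) ht hu hind hlaw hK (hσ i)).trans ?_
      have e1 : 2 * (w * κ / 4) / w * B = B / 2 * κ := by field_simp; norm_num
      have e2 : 3 * B ^ 2 / (2 * κ ^ 3 * K) = 3 * B ^ 2 / 2 * κ := by
        have : (K : ℝ) = (κ ^ 4)⁻¹ := by rw [hκ4, inv_inv]
        rw [this]; field_simp
      have e3 : 3 * κ ^ 3 * B ^ 2 / (2 * (w * κ / 4) ^ 2) = 24 * B ^ 2 / w ^ 2 * κ := by
        field_simp; ring
      have e4 : B / K ≤ B * κ := by
        rw [div_eq_mul_inv, ← hκ4]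
        exact mul_le_mul_of_nonneg_left (pow_le_of_le_one hκ0.le hκ1 (by norm_num)) hB0
      rw [e1, e2, e3]
      linarith
    refine (Finset.sum_le_card_nsmul _ _ _ hone).trans (le_of_eq ?_)
    simp only [Finset.card_univ, Fintype.card_fin, nsmul_eq_mul]
    ring
  refine ⟨integrable_finsetSum _ fun i _ => hint i, fun τ hτ => ?_, fun m hm hIC hIR => ?_⟩
  · rw [DataMarket.rev_postedPrice]
    exact hregret τ hτ
  · obtain ⟨σ, hσ, hle⟩ := DataMarket.Mechanism.exists_thresholds_rev_le hM hm hIC hIR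
    exact (sub_le_sub_right hle _).trans (hregret σ hσ)
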